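/- Let $m \ge 2$ and let $h_1, \dots, h_m$ be complex numbers. Let $z_2, \dots, z_m$ be the roots, with multiplicities, of $P(z) = \frac{d}{dz}\prod_{j=1}^m (z - h_j)$, and put $z_1 = \frac1m \sum_{j=1}^m h_j$. Suppose that the $2m-1$ numbers $h_1,\dots,h_m,z_2,\dots,z_m$ are pairwise distinct, and that no $h_j$ belongs to the set $$\Big\{ -\tfrac{\rho}{2\pi}\cot\tfrac{\rho}{2} \;:\; \rho \in \mathbb C,\ \rho \ne 0,\ \sin\rho = \rho \Big\}$$ (this means that the zeros of $\varphi_j(\pi,\cdot)$ below are simple). Put $$\varphi_j(x,\lambda) = \cos(\sqrt\lambda\, x) + h_j\, \frac{\sin(\sqrt\lambda\, x)}{\sqrt\lambda}, \qquad j = 1,\dots,m,$$ which is entire in $\lambda$ (with $\varphi_j(x,0) = 1 + h_j x$), and let the dot denote $\partial/\partial\lambda$. Let $\{\lambda_{nk}\}_{n \ge 0,\, 1\le k\le m}$ be arbitrary complex numbers such that for all $n \ge 1$ $$\sqrt{\lambda_{n1}} = n + \frac{z_1}{\pi n} + \frac{\varkappa_{n1}}{n}, \qquad \sqrt{\lambda_{nk}}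 = n + \tfrac12 + \frac{z_k}{\pi (n+\frac12)} + \frac{\varkappa_{nk}}{n^2}, \quad k = 2,\dots,m,$$ where $\sum_{n,k} |\varkappa_{nk}|^2 < \infty$ and $\sqrt{\cdot}$ is the principal square root. For $\mu_0 \in \mathbb C$ and $\nu \ge 0$ define the vector function $y^{\langle\nu\rangle}_{\mu_0} = [y^{\langle\nu\rangle}_{\mu_0,j}]_{j=1}^m$ on $(0,\pi)$ as follows. (i) If $\varphi_j(\pi,\mu_0) \neq 0$ for all $j$, then $$y^{\langle\nu\rangle}_{\mu_0,j}(x) = \frac{d^\nu}{d\lambda^\nu}\, \frac{\varphi_j(x,\lambda)}{\varphi_j(\pi,\lambda)} \Big|_{\lambda=\mu_0}, \qquad j = 1,\dots,m.$$ (ii) If $\varphi_s(\pi,\mu_0) = 0$ for some (necessarily unique) $s$, then $$y^{\langle\nu\rangle}_{\mu_0,s}(x) = \frac{d^\nu}{d\lambda^\nu}\, \frac{\varphi_s(x,\lambda)}{\dot\varphi_s(\pi,\mu_0)}\Big|_{\lambda=\mu_0}, \qquad y^{\langle\nu\rangle}_{\mu_0,j}(x) = \frac{d^\nu}{d\lambda^\nu}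 \left( \frac{\varphi_s(\pi,\lambda)}{\dot\varphi_s(\pi,\mu_0)}\cdot\frac{\varphi_j(x,\lambda)}{\varphi_j(\pi,\lambda)}\right)\Big|_{\lambda=\mu_0}, \quad j\ne s.$$ For each $(n,k)$ let $\nu(n,k)$ be the (finite) number of index pairs $(l,r)$ that precede $(n,k)$ lexicographically and satisfy $\lambda_{lr} = \lambda_{nk}$; put $y_{nk} = y^{\langle\nu(n,k)\rangle}_{\lambda_{nk}}$ and $$v_{n1} = (-1)^n y_{n1}, \qquad v_{nk} = \frac{(-1)^n}{n+\frac12}\, y_{nk}, \quad k = 2,\dots,m.$$ Then every component of every $v_{nk}$ belongs to $L_2(0,\pi)$, and $\{v_{nk}\}_{n\ge0,\,1\le k\le m}$ is a Riesz basis of the Hilbert space $L_2(0,\pi)^m$ with the inner product $(y,u) = \sum_{j=1}^m \int_0^\pi \overline{y_j(x)}\, u_j(x)\,dx$; that is, it is the image of an orthonormal basis under a bounded linear operator with bounded inverse. -/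

import Mathlib

noncomputable section

namespace StarGraph

open MeasureTheory

/-- `φ(x, μ) = cos (√μ x) + h sin (√μ x) / √μ`, an entire function of `μ`; its value at `μ = 0`
is the limit `1 + h x`. -/
def phi (h : ℂ) (x : ℝ) (μ : ℂ) : ℂ :=
  if μ = 0 then 1 + h * x
  else Complex.cos (Complex.sqrt μ * x) + h * (Complex.sin (Complex.sqrt μ * x) / Complex.sqrt μ)

/-- The polynomial `P(z) = d/dz ∏ⱼ (z - hⱼ)`. -/
def critPoly {m : ℕ} (h : Fin m → ℂ) : Polynomial ℂ :=
  Polynomial.derivative (∏ j, (Polynomial.X - Polynomial.C (h j)))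

/-- The class `ℂ^m_*`: the numbers `hⱼ`, `j = 1, …, m`, together with the `m - 1` roots of `P`
(counted with multiplicities) are all distinct. -/
def CStar {m : ℕ} (h : Fin m → ℂ) : Prop :=
  Function.Injective h ∧ (critPoly h).roots.Nodup ∧ ∀ j, h j ∉ (critPoly h).roots

/-- The exceptional set `Z_h`: `-(ρ / 2π) cot (ρ / 2)`, where `ρ ≠ 0` and `sin ρ = ρ`. -/
def exceptionalSet : Set ℂ :=
  {w | ∃ ρ : ℂ, ρ ≠ 0 ∧ Complex.sin ρ = ρ ∧ w = -(ρ / (2 * Real.pi)) * Complex.cot (ρ / 2)}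

/-- The numbers `z₁, …, z_m`: `z₁` is the mean of the `hⱼ`, and `z₂, …, z_m` enumerate the roots
of `P` with multiplicities. The mathematical index `k = 1, …, m` is `(k : Fin m) + 1` here. -/
def IsZNumbers {m : ℕ} (h z : Fin m → ℂ) : Prop :=
  (∀ k : Fin m, k.val = 0 → z k = (∑ j, h j) / m) ∧
    (Finset.univ.filter (fun k : Fin m => k.val ≠ 0)).val.map z = (critPoly h).roots

/-- The asymptotic relations for `λ_{nk}`, with remainders governed by an `ℓ²` family `ϰ`. -/
def HasAsymptotics {m : ℕ} (z : Fin m → ℂ) (lam : ℕ → Fin m → ℂ) : Prop :=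
  ∃ ϰ : ℕ → Fin m → ℂ, Summable (fun p : ℕ × Fin m => ‖ϰ p.1 p.2‖ ^ 2) ∧
    ∀ n : ℕ, 1 ≤ n → ∀ k : Fin m,
      Complex.sqrt (lam n k) =
        if k.val = 0 then (n : ℂ) + z k / (Real.pi * n) + ϰ n k / n
        else (n : ℂ) + 1 / 2 + z k / (Real.pi * ((n : ℂ) + 1 / 2)) + ϰ n k / (n : ℂ) ^ 2

open Classical in
/-- The `j`-th component at `x` of the chain element `y^{<ν>}` attached to the value `μ₀`.
If no `φ_s(π, μ₀)` vanishes, it is the `ν`-th `μ`-derivative at `μ₀` of `φ_j(x, μ) / φ_j(π, μ)`.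
If `φ_s(π, μ₀) = 0` (for distinct `h_j` such an index `s` is unique), it is the `ν`-th
`μ`-derivative at `μ₀` of the same vector function multiplied by `φ_s(π, μ) / φ_s˙(π, μ₀)`,
whose `s`-th component is `φ_s(x, μ) / φ_s˙(π, μ₀)`. -/
def chain {m : ℕ} (h : Fin m → ℂ) (μ₀ : ℂ) (ν : ℕ) (j : Fin m) (x : ℝ) : ℂ :=
  if hs : ∃ s, phi (h s) Real.pi μ₀ = 0 then
    if j = hs.choose then
      iteratedDeriv ν
        (fun μ => phi (h j) x μ / deriv (phi (h j) Real.pi) μ₀) μ₀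
    else
      iteratedDeriv ν
        (fun μ => phi (h hs.choose) Real.pi μ / deriv (phi (h hs.choose) Real.pi) μ₀ *
          (phi (h j) x μ / phi (h j) Real.pi μ)) μ₀
  else
    iteratedDeriv ν (fun μ => phi (h j) x μ / phi (h j) Real.pi μ) μ₀

/-- The number of indices that precede `(n, k)` lexicographically and carry the same value
`λ_{nk}`; that is, `s - 1` when `(n, k) = (n_s, k_s)` is the `s`-th occurrence of this value. -/
def chainPos {m : ℕ} (lam : ℕ → Fin m → ℂ) (n : ℕ) (k : Fin m) : ℕ :=
  Set.ncard {p : ℕ × Fin m | toLex p < toLex (n, k) ∧ lam p.1 p.2 = lam n k}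

/-- The `j`-th component of the vector function `y_{nk}`. -/
def yFun {m : ℕ} (h : Fin m → ℂ) (lam : ℕ → Fin m → ℂ) (n : ℕ) (k j : Fin m) (x : ℝ) : ℂ :=
  chain h (lam n k) (chainPos lam n k) j x

/-- The `j`-th component of the normalized vector function `v_{nk}`. -/
def vFun {m : ℕ} (h : Fin m → ℂ) (lam : ℕ → Fin m → ℂ) (n : ℕ) (k j : Fin m) (x : ℝ) : ℂ :=
  if k.val = 0 then (-1) ^ n * yFun h lam n k j x
  else (-1) ^ n / ((n : ℂ) + 1 / 2) * yFun h lam n k j x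

/-- Lebesgue measure on `(0, π)`. -/
abbrev volPi : Measure ℝ := volume.restrict (Set.Ioo 0 Real.pi)

/-- The Hilbert space `L₂(0, π)^m`, with `(y, u) = ∑ⱼ ∫₀^π conj (yⱼ) uⱼ`. -/
abbrev HSpace (m : ℕ) : Type := PiLp 2 (fun _ : Fin m => Lp ℂ 2 volPi)

/-- A Riesz basis: the image of an orthonormal basis under a bounded linear operator with
bounded inverse. -/
def IsRieszBasis {ι E : Type*} [NormedAddCommGroup E] [InnerProductSpace ℂ E] (f : ι → E) : Prop :=
  ∃ (b : HilbertBasis ι ℂ E) (T : E ≃L[ℂ] E), ∀ i, f i = T (b i)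

end StarGraph

end

noncomputable section

namespace StarGraph

section

open MeasureTheory

/-! ### Quadratically close systems and finite perturbations of Riesz bases. -/

section Bari
variable {ι E : Type*} [NormedAddCommGroup E] [InnerProductSpace ℂ E] [CompleteSpace E]

/-! For a vector `f` put G_j(μ) = ∫ f_j φ_j(·, μ) (`trans`) and F_f(μ) = ∑_j (∏_{i ≠ j} φ_i(π, μ))
G_j(μ) (`charF`). Up to a nonvanishing analytic factor, a chain at μ₀ consists of the μ-derivatives
of the vector with components (∏_{i ≠ j} φ_i(π, μ)) φ_j(·, μ). Hence `f` annihilates the first N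
members of the chain exactly when F_f vanishes to order N at μ₀ (`exists_chainC`). This uses that at
most one φ_s(π, ·) vanishes at μ₀, and only to first order (`deriv_phi_pi_ne_zero`).

The asymptotics of λ_{nk} give v_{nk,j} = A_{jk} cos((n + a_k)x) + O(1/n), where a_1 = 0 and A_{j1}
= 1, while a_k = 1/2 and A_{jk} = 1/(h_j - z_k) for k ≥ 2 (`vFun_sub_isBigO`). The matrix A is
invertible (`isUnit_cauchy`) and both cosine systems are orthogonal bases, so the leading terms form
a Riesz basis up to finitely many vectors. The errors are square summable, so `v` coincides off a
finite set S with a Riesz basis T b, and a Fredholm alternative (`isRieszBasis_of_finite_change`)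
leaves only completeness of `v` to be proved.

For completeness let `f` annihilate every v_{nk}. Then F_f can be divided by any ∏_{p ∈ t} (μ -
λ_p), t ⊆ S, and the quotient is again some F_y (`exists_charF_div`). Quotients for card S + 1 sets
`t` of different sizes have a nontrivial combination w orthogonal to T b_p for p ∈ S. Moreover F_w
∏_S (μ - λ_p) = Q F_f with a polynomial Q ≠ 0, so w also annihilates v_p for p ∉ S. Thus w = 0, and
then F_f = 0. It remains to see that F_f = 0 forces f = 0. The space of such `f` is finite
dimensional, and division at μ = 1 acts on it; were it nonzero, this operator would have an
eigenvector, which is impossible (`nullF_eq_bot`). -/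

theorem exists_clm_of_summable_sq (b : HilbertBasis ι ℂ E) (w : ι → E)
    (hw : Summable fun p => ‖w p‖ ^ 2) :
    ∃ K : E →L[ℂ] E, (∀ p, K (b p) = w p) ∧ ‖K‖ ≤ Real.sqrt (∑' p, ‖w p‖ ^ 2) := by
  have hx : ∀ x : E, HasSum (fun p => ‖b.repr x p‖ ^ 2) (‖x‖ ^ 2) := fun x => by
    have := lp.hasSum_norm (p := 2) (by norm_num) (b.repr x)
    simpa using this
  -- Cauchy–Schwarz combined with Parseval: the Hilbert–Schmidt bound for K x = ∑ ⟨b p, x⟩ w p.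
  have key : ∀ x : E, Summable (fun p => ‖b.repr x p‖ * ‖w p‖) ∧
      ∑' p, ‖b.repr x p‖ * ‖w p‖ ≤ Real.sqrt (∑' p, ‖w p‖ ^ 2) * ‖x‖ := fun x => by
    have := Real.summable_and_inner_le_Lp_mul_Lq_tsum_of_nonneg (p := 2) (q := 2)
      (by constructor <;> norm_num)
      (f := fun p => ‖b.repr x p‖) (g := fun p => ‖w p‖) (fun _ => norm_nonneg _)
      (fun _ => norm_nonneg _) (by simpa using (hx x).summable) (by simpa using hw)
    refine ⟨this.1, this.2.trans (le_of_eq ?_)⟩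
    simp only [Real.rpow_two, (hx x).tsum_eq, ← Real.sqrt_eq_rpow]
    rw [Real.sqrt_sq (norm_nonneg _), mul_comm]
  have hs : ∀ x : E, Summable fun p => b.repr x p • w p := fun x =>
    Summable.of_norm (by simpa [norm_smul] using (key x).1)
  let L : E →ₗ[ℂ] E :=
    { toFun := fun x => ∑' p, b.repr x p • w p
      map_add' := fun x y => by
        rw [← (hs x).tsum_add (hs y)]; simp [add_smul]
      map_smul' := fun c x => by
        simp only [RingHom.id_apply]; rw [← (hs x).tsum_const_smul]; simp [mul_smul] }
  have hL : ∀ x, ‖L x‖ ≤ Real.sqrt (∑' p, ‖w p‖ ^ 2) * ‖x‖ := fun x => by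
    refine (norm_tsum_le_tsum_norm (by simpa [norm_smul] using (key x).1)).trans ?_
    simpa [norm_smul] using (key x).2
  refine ⟨L.mkContinuous _ hL, fun p => ?_, L.mkContinuous_norm_le (Real.sqrt_nonneg _) hL⟩
  classical
  simp only [LinearMap.mkContinuous_apply]
  change ∑' q, b.repr (b p) q • w q = w p
  rw [tsum_eq_single p]
  · simp [b.repr_self]
  · intro q hq; simp [b.repr_self, hq]

theorem exists_equiv_of_small (T₀ : E ≃L[ℂ] E) : ∃ ε > 0, ∀ K : E →L[ℂ] E, ‖K‖ < ε →
    ∃ T : E ≃L[ℂ] E, ∀ x, T x = T₀ x + K x := by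
  have := ContinuousLinearEquiv.nhds T₀
  obtain ⟨ε, hε, h⟩ := Metric.mem_nhds_iff.1 this
  refine ⟨ε, hε, fun K hK => ?_⟩
  obtain ⟨T, hT⟩ := h (show (T₀ : E →L[ℂ] E) + K ∈ _ by simpa [Metric.mem_ball, dist_eq_norm] using hK)
  exact ⟨T, fun x => by simpa using DFunLike.congr_fun hT x⟩

/-- The perturbation K sends b p to the error for p ∉ S and to 0 on S, so its norm is controlled by
a tail of the sum of squares. All large S are allowed because S is later taken to be a whole disc of
values λ. -/
theorem exists_equiv_of_quadratically_close (b : HilbertBasis ι ℂ E) (T₀ : E ≃L[ℂ] E) (v : ι → E)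
    (hv : Summable fun p => ‖v p - T₀ (b p)‖ ^ 2) :
    ∃ S₀ : Finset ι, ∀ S : Finset ι, S₀ ⊆ S → ∃ T : E ≃L[ℂ] E,
      (∀ p ∈ S, T (b p) = T₀ (b p)) ∧ ∀ p ∉ S, T (b p) = v p := by
  classical
  obtain ⟨ε, hε, H⟩ := exists_equiv_of_small T₀
  have ht := (tendsto_order.1 (tendsto_tsum_compl_atTop_zero fun p => ‖v p - T₀ (b p)‖ ^ 2)).2
    (ε ^ 2) (by positivity)
  obtain ⟨S₀, hS₀⟩ := Filter.eventually_atTop.1 ht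
  refine ⟨S₀, fun S hS => ?_⟩
  let w : ι → E := fun p => if p ∈ S then 0 else v p - T₀ (b p)
  have hw2 : (fun p => ‖w p‖ ^ 2) =
      (((S : Set ι)ᶜ).indicator fun p => ‖v p - T₀ (b p)‖ ^ 2) := by
    ext p; by_cases hp : p ∈ S <;> simp [w, hp]
  have hws : Summable fun p => ‖w p‖ ^ 2 := by rw [hw2]; exact hv.indicator _
  obtain ⟨K, hK, hKn⟩ := exists_clm_of_summable_sq b w hws
  obtain ⟨T, hT⟩ := H K (hKn.trans_lt (by
    rw [Real.sqrt_lt' hε, hw2]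
    have := hS₀ S hS
    rw [← tsum_subtype]
    exact this))
  refine ⟨T, fun p hp => ?_, fun p hp => ?_⟩ <;> simp [hT, hK, w, hp]

/-- A Fredholm alternative: T⁻¹ v is the image of b under N = identity + finite rank, and
completeness of v gives N dense range, which for such an operator already means bijectivity. -/
theorem isRieszBasis_of_finite_change (b : HilbertBasis ι ℂ E) (T : E ≃L[ℂ] E) (v : ι → E)
    (S : Finset ι) (hS : ∀ p ∉ S, v p = T (b p))
    (hv : (Submodule.span ℂ (Set.range v)).topologicalClosure = ⊤) : IsRieszBasis v := by
  classical
  let π' : E →L[ℂ] (S → ℂ) := ContinuousLinearMap.pi fun p => innerSL ℂ (b p)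
  let d : S → E := fun p => T.symm (v p) - b p
  let J : (S → ℂ) →L[ℂ] E :=
    ∑ p : S, (ContinuousLinearMap.proj (R := ℂ) (φ := fun _ : S => ℂ) p).smulRight (d p)
  have hJ : ∀ c, J c = ∑ p, c p • d p := fun c => by simp [J]
  let N : E →L[ℂ] E := ContinuousLinearMap.id ℂ E + J.comp π'
  have hπ : ∀ q p, π' (b q) p = if q = p then 1 else 0 := fun q p => by
    simp only [π', ContinuousLinearMap.coe_pi', innerSL_apply_apply]
    rw [orthonormal_iff_ite.1 b.orthonormal]; simp [eq_comm]
  have hNb : ∀ q, N (b q) = T.symm (v q) := fun q => by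
    simp only [N, add_apply, ContinuousLinearMap.id_apply,
      ContinuousLinearMap.comp_apply, hJ, hπ]
    by_cases hq : q ∈ S
    · rw [Finset.sum_eq_single ⟨q, hq⟩]
      · simp [d]
      · intro p _ hp
        rw [if_neg, zero_smul]; rintro rfl; exact hp rfl
      · simp
    · rw [Finset.sum_eq_zero, hS q hq]; · simp
      intro p _; rw [if_neg, zero_smul]; rintro rfl; exact hq p.2
  -- L is the operator that N induces on the coordinates in S. N is bijective as soon as this finite
  -- matrix is.
  let L : (S → ℂ) →ₗ[ℂ] (S → ℂ) := (ContinuousLinearMap.id ℂ (S → ℂ) + π'.comp J : (S → ℂ) →L[ℂ] (S → ℂ))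
  have hπN : ∀ x, π' (N x) = L (π' x) := fun x => by simp [N, L]
  have hL : Function.Surjective L := by
    have hπs : Function.Surjective π' := fun c => by
      refine ⟨∑ p, c p • b p, ?_⟩
      ext q
      rw [map_sum, Finset.sum_apply]
      rw [Finset.sum_eq_single q]
      · simp [hπ]
      · intro p _ hp
        rw [map_smul, Pi.smul_apply, hπ, if_neg, smul_zero]; exact fun h => hp (Subtype.ext h)
      · simp
    have hd : DenseRange (fun x => π' (N x)) := by
      refine hπs.denseRange.comp ?_ π'.continuous
      have h1 : DenseRange (T.symm ∘ ((Submodule.span ℂ (Set.range v)).subtype)) := by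
        refine T.symm.surjective.denseRange.comp ?_ T.symm.continuous
        have := Submodule.dense_iff_topologicalClosure_eq_top.2 hv
        simpa [DenseRange] using this
      refine h1.mono ?_
      rintro _ ⟨⟨y, hy⟩, rfl⟩
      have : Submodule.span ℂ (Set.range v) ≤ (LinearMap.range (N : E →ₗ[ℂ] E)).map (T : E →ₗ[ℂ] E) := by
        rw [Submodule.span_le]
        rintro _ ⟨p, rfl⟩
        exact ⟨N (b p), ⟨b p, rfl⟩, by simp [hNb]⟩
      obtain ⟨_, ⟨x, rfl⟩, hx⟩ := this hy
      exact ⟨x, by simp [← hx]⟩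
    rw [← LinearMap.range_eq_top]
    have hcl : IsClosed (LinearMap.range L : Set (S → ℂ)) := Submodule.closed_of_finiteDimensional _
    rw [Submodule.eq_top_iff']
    intro c
    have hc := hd c
    refine (hcl.closure_subset_iff.2 ?_) hc
    rintro _ ⟨x, rfl⟩
    exact ⟨π' x, (hπN x).symm⟩
  have hLi : Function.Injective L := LinearMap.injective_iff_surjective.2 hL
  have hNi : Function.Injective N := by
    rw [injective_iff_map_eq_zero]
    intro x hx
    have h0 : π' x = 0 := hLi (by rw [← hπN, hx]; simp)
    simpa [N, h0] using hx
  have hNs : Function.Surjective N := fun y => by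
    obtain ⟨c, hc⟩ := hL (π' y)
    have hc' : c + π' (J c) = π' y := by simpa [L] using hc
    have : π' (y - J c) = c := by rw [map_sub, ← hc']; simp
    exact ⟨y - J c, by simp only [N, add_apply, ContinuousLinearMap.id_apply,
      ContinuousLinearMap.comp_apply, this]; simp⟩
  let Ne : E ≃L[ℂ] E := ContinuousLinearEquiv.ofBijective N
    (LinearMap.ker_eq_bot.2 hNi) (LinearMap.range_eq_top.2 hNs)
  refine ⟨b, Ne.trans T, fun p => ?_⟩
  have : Ne (b p) = N (b p) := rfl
  simp [this, hNb]

end Bari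

end

/-! ### The solutions φ, their analyticity in μ, and the bilinear pairing. -/

section

open MeasureTheory

/-- `cos (√μ x)` -/
def cosq (x : ℝ) (μ : ℂ) : ℂ := Complex.cos (Complex.sqrt μ * x)

/-- `sin (√μ x) / √μ` -/
def sinq (x : ℝ) (μ : ℂ) : ℂ :=
  if μ = 0 then (x : ℂ) else Complex.sin (Complex.sqrt μ * x) / Complex.sqrt μ

theorem csqrt_sq (μ : ℂ) : Complex.sqrt μ ^ 2 = μ := by
  unfold Complex.sqrt
  rw [← Complex.cpow_nat_mul]; norm_num

theorem csqrt_ne_zero {μ : ℂ} (hμ : μ ≠ 0) : Complex.sqrt μ ≠ 0 := fun h0 => by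
  apply hμ; rw [← csqrt_sq μ, h0]; norm_num

@[simp] theorem csqrt_zero : Complex.sqrt 0 = 0 := by
  simp [Complex.sqrt]

theorem phi_eq (h : ℂ) (x : ℝ) (μ : ℂ) : phi h x μ = cosq x μ + h * sinq x μ := by
  unfold phi cosq sinq
  split_ifs with h0
  · simp [h0]
  · rfl

theorem hasDerivAt_cosq (μ : ℂ) (x : ℝ) :
    HasDerivAt (fun x : ℝ => cosq x μ) (-μ * sinq x μ) x := by
  have h1 : HasDerivAt (fun x : ℝ => Complex.sqrt μ * (x : ℂ)) (Complex.sqrt μ * 1) x :=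
    (Complex.ofRealCLM.hasDerivAt (x := x)).const_mul _
  have h2 := (Complex.hasDerivAt_cos (Complex.sqrt μ * x)).comp x h1
  convert! h2 using 1
  unfold sinq
  split_ifs with h0
  · simp [h0]
  · have := csqrt_ne_zero h0
    field_simp
    rw [csqrt_sq]

theorem hasDerivAt_sinq (μ : ℂ) (x : ℝ) :
    HasDerivAt (fun x : ℝ => sinq x μ) (cosq x μ) x := by
  have h1 : HasDerivAt (fun x : ℝ => Complex.sqrt μ * (x : ℂ)) (Complex.sqrt μ * 1) x :=
    (Complex.ofRealCLM.hasDerivAt (x := x)).const_mul _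
  unfold sinq cosq
  split_ifs with h0
  · simp only [h0, csqrt_zero, zero_mul, Complex.cos_zero]
    exact Complex.ofRealCLM.hasDerivAt (x := x)
  · have h2 := ((Complex.hasDerivAt_sin (Complex.sqrt μ * x)).comp x h1).div_const (Complex.sqrt μ)
    convert! h2 using 1
    have := csqrt_ne_zero h0
    field_simp

theorem continuous_cosq (μ : ℂ) : Continuous fun x : ℝ => cosq x μ :=
  continuous_iff_continuousAt.2 fun x => (hasDerivAt_cosq μ x).continuousAt

theorem continuous_sinq (μ : ℂ) : Continuous fun x : ℝ => sinq x μ :=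
  continuous_iff_continuousAt.2 fun x => (hasDerivAt_sinq μ x).continuousAt

theorem continuous_phi (h μ : ℂ) : Continuous fun x : ℝ => phi h x μ := by
  simp only [phi_eq]
  exact (continuous_cosq μ).add (continuous_const.mul (continuous_sinq μ))

theorem cosq_sq_add (x : ℝ) (μ : ℂ) : cosq x μ ^ 2 + μ * sinq x μ ^ 2 = 1 := by
  unfold cosq sinq
  split_ifs with h0
  · simp [h0]
  · have := csqrt_ne_zero h0
    rw [div_pow, csqrt_sq]
    field_simp
    rw [add_comm]; exact Complex.sin_sq_add_cos_sq _

@[simp] theorem cosq_zero_left (μ : ℂ) : cosq 0 μ = 1 := by simp [cosq]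
@[simp] theorem sinq_zero_left (μ : ℂ) : sinq 0 μ = 0 := by simp [sinq]

/-- Only even powers of √μ occur, so this is a power series in μ and the cut of the root is
invisible. -/
theorem hasSum_cosq (x : ℝ) (μ : ℂ) :
    HasSum (fun n : ℕ => ((-1) ^ n * μ ^ n / ((2 * n).factorial : ℂ)) * (x : ℂ) ^ (2 * n))
      (cosq x μ) := by
  have := Complex.hasSum_cos (Complex.sqrt μ * x)
  unfold cosq
  convert! this using 2 with n
  rw [mul_pow, pow_mul (Complex.sqrt μ), csqrt_sq]; ring

theorem hasSum_sinq (x : ℝ) (μ : ℂ) :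
    HasSum (fun n : ℕ => ((-1) ^ n * μ ^ n / ((2 * n + 1).factorial : ℂ)) * (x : ℂ) ^ (2 * n + 1))
      (sinq x μ) := by
  unfold sinq
  split_ifs with h0
  · subst h0
    convert! hasSum_ite_eq 0 (x : ℂ) using 2 with n
    split_ifs with hn <;> simp [hn]
  · have := (Complex.hasSum_sin (Complex.sqrt μ * x)).div_const (Complex.sqrt μ)
    have h1 := csqrt_ne_zero h0
    convert! this using 2 with n
    rw [mul_pow, pow_succ (Complex.sqrt μ), pow_mul (Complex.sqrt μ), csqrt_sq]
    field_simp

/-- Continuous functions on `[0, π]`. -/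
abbrev CPi : Type := C(Set.Icc (0 : ℝ) Real.pi, ℂ)

/-- The coordinate function. -/
def coordPi : CPi := ⟨fun x => ((x : ℝ) : ℂ), by fun_prop⟩

theorem norm_coordPi_le : ‖coordPi‖ ≤ Real.pi :=
  (ContinuousMap.norm_le _ Real.pi_pos.le).2 fun x => by
    simp only [coordPi, ContinuousMap.coe_mk, Complex.norm_real, Real.norm_eq_abs]
    rw [abs_of_nonneg x.2.1]; exact x.2.2

theorem summable_bound_aux (R : ℝ) (f : ℕ → ℕ) (hf : Function.Injective f) (a : ℝ) (ha : 0 ≤ a)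
    (hR : 0 ≤ R) (hfa : ∀ n, 2 * n ≤ f n) :
    Summable fun n => R ^ n / ((f n).factorial : ℝ) * a ^ (f n) := by
  have h1 := (Real.summable_pow_div_factorial ((R + 1) * (a + 1))).comp_injective hf
  refine Summable.of_nonneg_of_le (fun n => by positivity) (fun n => ?_) h1
  simp only [Function.comp_apply]
  rw [mul_pow, div_mul_eq_mul_div]
  gcongr ?_ * ?_ / _
  · calc R ^ n ≤ (R + 1) ^ n := by gcongr; linarith
      _ ≤ (R + 1) ^ f n := pow_le_pow_right₀ (by linarith) (by linarith [hfa n])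
  · gcongr; linarith

theorem norm_coordPi_pow_le (n : ℕ) : ‖coordPi ^ n‖ ≤ Real.pi ^ n :=
  (ContinuousMap.norm_le _ (by positivity)).2 fun x => by
    rw [ContinuousMap.pow_apply, norm_pow]
    gcongr
    exact (coordPi.norm_coe_le_norm x).trans norm_coordPi_le

/-- Analyticity is needed with values in C[0, π]: then μ-derivatives commute with point evaluation
and with integration against an L₂ function. The condition 2n ≤ f n lets an exponential series
dominate. -/
theorem differentiable_series (f : ℕ → ℕ) (hf : Function.Injective f)
    (hfa : ∀ n, 2 * n ≤ f n) :
    Differentiable ℂ (fun μ : ℂ =>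
      ∑' n, ((-1) ^ n * μ ^ n / ((f n).factorial : ℂ)) • coordPi ^ (f n)) ∧
    ∀ μ : ℂ, Summable fun n => ((-1) ^ n * μ ^ n / ((f n).factorial : ℂ)) • coordPi ^ (f n) := by
  have bound : ∀ R : ℝ, ∀ (n : ℕ) (μ : ℂ), ‖μ‖ ≤ R →
      ‖((-1) ^ n * μ ^ n / ((f n).factorial : ℂ)) • coordPi ^ (f n)‖ ≤
        R ^ n / ((f n).factorial : ℝ) * Real.pi ^ (f n) := fun R n μ hμ => by
    rw [norm_smul, norm_div, norm_mul, norm_pow, norm_pow, norm_neg, norm_one, one_pow, one_mul,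
      Complex.norm_natCast]
    exact mul_le_mul (by gcongr) (norm_coordPi_pow_le _) (norm_nonneg _)
      (by have := (norm_nonneg μ).trans hμ; positivity)
  constructor
  · intro μ
    have hR : 0 ≤ ‖μ‖ + 1 := by positivity
    have := Complex.differentiableOn_tsum_of_summable_norm
      (F := fun n (μ : ℂ) => ((-1) ^ n * μ ^ n / ((f n).factorial : ℂ)) • coordPi ^ (f n))
      (U := Metric.ball 0 (‖μ‖ + 1))
      (summable_bound_aux (‖μ‖ + 1) f hf Real.pi Real.pi_pos.le hR hfa)
      (fun n => by fun_prop) Metric.isOpen_ball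
      (fun n w hw => bound _ n w (by simpa using (mem_ball_zero_iff.1 hw).le))
    exact this.differentiableAt (Metric.isOpen_ball.mem_nhds (by simp))
  · intro μ
    exact Summable.of_norm_bounded (summable_bound_aux ‖μ‖ f hf Real.pi Real.pi_pos.le
      (norm_nonneg _) hfa) (fun n => bound _ n μ le_rfl)

/-- `φ(·, μ)` as a continuous function on `[0, π]`. -/
def phiC (h μ : ℂ) : CPi := ⟨fun x => phi h x μ, (continuous_phi h μ).comp continuous_subtype_val⟩

theorem differentiable_phiC (h : ℂ) : Differentiable ℂ (phiC h) := by
  obtain ⟨d1, s1⟩ := differentiable_series (fun n => 2 * n) (fun a b hab => by simpa using hab)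
    (fun n => le_rfl)
  obtain ⟨d2, s2⟩ := differentiable_series (fun n => 2 * n + 1) (fun a b hab => by simpa using hab)
    (fun n => by omega)
  have : phiC h = fun μ => (∑' n : ℕ, ((-1) ^ n * μ ^ n / ((2 * n).factorial : ℂ)) • coordPi ^ (2 * n))
      + h • ∑' n : ℕ, ((-1) ^ n * μ ^ n / ((2 * n + 1).factorial : ℂ)) • coordPi ^ (2 * n + 1) := by
    ext μ x
    have e1 := ((ContinuousMap.evalCLM ℂ x).hasSum (s1 μ).hasSum).unique
      (by simpa [coordPi] using hasSum_cosq x μ)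
    have e2 := ((ContinuousMap.evalCLM ℂ x).hasSum (s2 μ).hasSum).unique
      (by simpa [coordPi] using hasSum_sinq x μ)
    simp only [ContinuousMap.evalCLM_apply] at e1 e2
    simp only [ContinuousMap.add_apply, ContinuousMap.smul_apply, e1, e2, phiC, phi_eq,
      ContinuousMap.coe_mk, smul_eq_mul]
  rw [this]
  exact d1.add (d2.const_smul h)

theorem differentiable_phi_pi (h : ℂ) : Differentiable ℂ (phi h Real.pi) := by
  let p : Set.Icc (0 : ℝ) Real.pi := ⟨Real.pi, Real.pi_pos.le, le_rfl⟩
  have := (ContinuousMap.evalCLM (R := ℂ) p).differentiable.comp (differentiable_phiC h)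
  exact this

/-- Extension of a continuous function by constants. -/
def extPi (u : CPi) : ℝ → ℂ := Set.IccExtend Real.pi_pos.le u

theorem continuous_extPi (u : CPi) : Continuous (extPi u) := u.continuous.Icc_extend'

theorem extPi_of_mem (u : CPi) {x : ℝ} (hx : x ∈ Set.Icc 0 Real.pi) : extPi u x = u ⟨x, hx⟩ :=
  Set.IccExtend_of_mem _ _ hx

theorem norm_extPi_le (u : CPi) (x : ℝ) : ‖extPi u x‖ ≤ ‖u‖ := u.norm_coe_le_norm _

theorem memLp_extPi (u : CPi) : MemLp (extPi u) 2 volPi :=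
  MemLp.of_bound (continuous_extPi u).aestronglyMeasurable ‖u‖ (.of_forall (norm_extPi_le u))

/-- The inclusion of `C[0, π]` into `L₂(0, π)`. -/
def toL2 : CPi →L[ℂ] Lp ℂ 2 volPi :=
  LinearMap.mkContinuous
    { toFun := fun u => (memLp_extPi u).toLp (extPi u)
      map_add' := fun u w => MemLp.toLp_add (memLp_extPi u) (memLp_extPi w)
      map_smul' := fun c u => MemLp.toLp_const_smul c (memLp_extPi u) }
    ((measureUnivNNReal volPi : ℝ) ^ ((2 : ENNReal).toReal)⁻¹)
    fun u => Lp.norm_le_of_ae_bound (norm_nonneg _) (by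
      filter_upwards [(memLp_extPi u).coeFn_toLp] with x hx
      exact (congrArg norm hx).trans_le (norm_extPi_le u x))

theorem coeFn_toL2 (u : CPi) : toL2 u =ᵐ[volPi] extPi u := (memLp_extPi u).coeFn_toLp

/-- The bilinear pairing `∫ f g`. -/
def pairing (f : Lp ℂ 2 volPi) : Lp ℂ 2 volPi →L[ℂ] ℂ := innerSL ℂ (star f)

theorem pairing_apply (f g : Lp ℂ 2 volPi) : pairing f g = ∫ x, f x * g x ∂volPi := by
  simp only [pairing, innerSL_apply_apply, L2.inner_def]
  refine integral_congr_ae ?_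
  filter_upwards [Lp.coeFn_star f] with x hx
  simp [hx, mul_comm]

theorem star_add_Lp (f g : Lp ℂ 2 volPi) : star (f + g) = star f + star g := by
  refine Lp.ext ?_
  filter_upwards [Lp.coeFn_star (f + g), Lp.coeFn_star f, Lp.coeFn_star g, Lp.coeFn_add f g,
    Lp.coeFn_add (star f) (star g)] with x h1 h2 h3 h4 h5
  rw [h5, Pi.add_apply, h1, Pi.star_apply, h4, Pi.add_apply, star_add, h2, h3]
  rfl

theorem star_smul_Lp (c : ℂ) (f : Lp ℂ 2 volPi) : star (c • f) = (starRingEnd ℂ c) • star f := by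
  refine Lp.ext ?_
  filter_upwards [Lp.coeFn_star (c • f), Lp.coeFn_star f, Lp.coeFn_smul c f,
    Lp.coeFn_smul (starRingEnd ℂ c) (star f)] with x h1 h2 h3 h4
  simp [h1, h2, h3, h4]

theorem norm_star_Lp (f : Lp ℂ 2 volPi) : ‖star f‖ = ‖f‖ := by
  rw [Lp.norm_def, Lp.norm_def]
  congr 1
  refine eLpNorm_congr_norm_ae ?_
  filter_upwards [Lp.coeFn_star f] with x h1
  simp [h1]

theorem pairing_add (f f' g : Lp ℂ 2 volPi) : pairing (f + f') g = pairing f g + pairing f' g := by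
  simp [pairing, star_add_Lp]

theorem pairing_smul (c : ℂ) (f g : Lp ℂ 2 volPi) : pairing (c • f) g = c * pairing f g := by
  simp [pairing, star_smul_Lp]

theorem pairing_toL2 (f : Lp ℂ 2 volPi) (u : CPi) :
    pairing f (toL2 u) = ∫ x, f x * extPi u x ∂volPi := by
  rw [pairing_apply]
  refine integral_congr_ae ?_
  filter_upwards [coeFn_toL2 u] with x hx
  rw [hx]

end

/-! ### The orthogonal bases cos nx and cos (n + 1/2)x. -/

section

open MeasureTheory

/-- `cos ((n + a) x)` on `[0, π]`. -/
def cosC (a : ℝ) (n : ℕ) : CPi := ⟨fun x => ((Real.cos ((n + a) * x) : ℝ) : ℂ), by fun_prop⟩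

theorem integrable_Lp (f : Lp ℂ 2 volPi) : Integrable f volPi :=
  (Lp.memLp f).integrable (by norm_num)

/-- The weight may vanish at the endpoints, as cos(x/2) does at π. -/
theorem Lp_eq_zero_of_integral_mul_eq_zero (f : Lp ℂ 2 volPi) (w : ℝ → ℂ) (hw : Continuous w)
    (hw0 : ∀ x ∈ Set.Ioo 0 Real.pi, w x ≠ 0)
    (H : ∀ u : CPi, ∫ x, f x * (w x * extPi u x) ∂volPi = 0) : f = 0 := by
  have hf : IntegrableOn f (Set.Ioo 0 Real.pi) := integrable_Lp f
  have h1 : LocallyIntegrableOn (fun x => f x * w x) (Set.Ioo 0 Real.pi) := by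
    have := (hf.locallyIntegrableOn).continuousOn_mul hw.continuousOn isOpen_Ioo.isLocallyClosed
    simpa [mul_comm] using this
  have h2 := isOpen_Ioo.ae_eq_zero_of_integral_contDiff_smul_eq_zero h1 (fun g hg _ hs => by
    have := H ⟨fun x => ((g x : ℝ) : ℂ), by have := hg.continuous; fun_prop⟩
    rw [← this, ← integral_indicator measurableSet_Ioo]
    refine integral_congr_ae (.of_forall fun x => ?_)
    by_cases hx : x ∈ Set.Ioo 0 Real.pi
    · simp only [Set.indicator_of_mem hx]
      rw [extPi_of_mem _ (Set.Ioo_subset_Icc_self hx)]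
      simp; ring
    · simp only [Set.indicator_of_notMem hx]
      have : g x = 0 := by
        by_contra h0
        exact hx (hs (subset_tsupport _ h0))
      simp [this])
  refine Lp.ext ?_
  have h3 : ∀ᵐ x ∂volPi, f x = 0 := by
    rw [ae_restrict_iff' measurableSet_Ioo]
    filter_upwards [h2] with x hx hm
    exact (mul_eq_zero.1 (hx hm)).resolve_right (hw0 x hm)
  filter_upwards [h3, Lp.coeFn_zero ℂ 2 volPi] with x hx hx0
  rw [hx, hx0]; rfl

/-- The span of the system is a module over the polynomials in cos x. For n = 0 the lower frequency
a - 1 is reflected to 1 - a, which has index 1 if a = 0 and index 0 if a = 1/2. -/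
theorem cosC_mul (a : ℝ) (ha : a = 0 ∨ a = 1 / 2) (n : ℕ) :
    cosC 0 1 * cosC a n ∈ Submodule.span ℂ (Set.range (cosC a)) := by
  have key : ∀ x : ℝ, Real.cos ((1 + 0) * x) * Real.cos ((n + a) * x) =
      1 / 2 * Real.cos ((n + 1 + a) * x) + 1 / 2 * Real.cos ((n - 1 + a) * x) := fun x => by
    have h1 : (n + 1 + a) * x = (n + a) * x + x := by ring
    have h2 : (n - 1 + a) * x = (n + a) * x - x := by ring
    rw [h1, h2, Real.cos_add, Real.cos_sub]; ring_nf
  obtain ⟨k, hk⟩ : ∃ k : ℕ, ∀ x : ℝ, Real.cos ((n - 1 + a) * x) = Real.cos ((k + a) * x) := by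
    rcases n with _ | n
    · rcases ha with rfl | rfl
      · exact ⟨1, fun x => by rw [← Real.cos_neg]; congr 1; push_cast; ring⟩
      · exact ⟨0, fun x => by rw [← Real.cos_neg]; congr 1; push_cast; ring⟩
    · exact ⟨n, fun x => by congr 1; push_cast; ring⟩
  have : cosC 0 1 * cosC a n = (1 / 2 : ℂ) • cosC a (n + 1) + (1 / 2 : ℂ) • cosC a k := by
    ext x
    have h1 := key x
    rw [hk] at h1
    simp only [cosC, ContinuousMap.mul_apply, ContinuousMap.coe_mk, ContinuousMap.add_apply,
      ContinuousMap.smul_apply, smul_eq_mul]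
    have h2 := congrArg (fun r : ℝ => (r : ℂ)) h1
    push_cast at h2 ⊢
    exact h2
  rw [this]
  exact add_mem (Submodule.smul_mem _ _ (Submodule.subset_span ⟨_, rfl⟩))
    (Submodule.smul_mem _ _ (Submodule.subset_span ⟨_, rfl⟩))

/-- For a = 1/2 the span is not an algebra, so Stone–Weierstrass is applied to the algebra generated
by cos x, which is injective on [0, π]. By the module property f · cos(ax) annihilates this algebra,
hence every continuous function. -/
theorem eq_zero_of_cos_moments (a : ℝ) (ha : a = 0 ∨ a = 1 / 2) (f : Lp ℂ 2 volPi)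
    (H : ∀ n, pairing f (toL2 (cosC a n)) = 0) : f = 0 := by
  let M := Submodule.span ℂ (Set.range (cosC a))
  have hM : ∀ w ∈ M, pairing f (toL2 w) = 0 := fun w hw => by
    induction hw using Submodule.span_induction with
    | mem x hx => obtain ⟨n, rfl⟩ := hx; exact H n
    | zero => simp
    | add x y _ _ hx hy => simp [hx, hy]
    | smul c x _ hx => simp [hx]
  let A := StarAlgebra.adjoin ℂ ({cosC 0 1} : Set CPi)
  have hA : ∀ u ∈ A, ∀ w ∈ M, u * w ∈ M ∧ star u * w ∈ M := fun u hu => by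
    induction hu using StarAlgebra.adjoin_induction with
    | mem x hx =>
      obtain rfl := hx
      have hst : star (cosC 0 1) = cosC 0 1 := by ext x; simp [cosC, ← Complex.cos_conj]
      intro w hw
      rw [hst, and_self]
      induction hw using Submodule.span_induction with
      | mem x hx => obtain ⟨n, rfl⟩ := hx; exact cosC_mul a ha n
      | zero => simp
      | add x y _ _ hx hy => rw [mul_add]; exact add_mem hx hy
      | smul c x _ hx => rw [mul_smul_comm]; exact Submodule.smul_mem _ _ hx
    | algebraMap r =>
      intro w hw
      refine ⟨?_, ?_⟩
      · rw [← Algebra.smul_def]; exact Submodule.smul_mem _ _ hw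
      · rw [← algebraMap_star_comm, ← Algebra.smul_def]; exact Submodule.smul_mem _ _ hw
    | add x y _ _ hx hy =>
      intro w hw
      rw [star_add, add_mul, add_mul]
      exact ⟨add_mem (hx w hw).1 (hy w hw).1, add_mem (hx w hw).2 (hy w hw).2⟩
    | mul x y _ _ hx hy =>
      intro w hw
      rw [star_mul', mul_assoc, mul_assoc]
      exact ⟨(hx _ (hy w hw).1).1, (hx _ (hy w hw).2).2⟩
    | star x _ hx =>
      intro w hw
      rw [star_star]
      exact ⟨(hx w hw).2, (hx w hw).1⟩
  have hsep : A.SeparatesPoints := fun x y hxy => by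
    refine ⟨cosC 0 1, ⟨cosC 0 1, StarAlgebra.self_mem_adjoin_singleton ℂ _, rfl⟩, fun h0 => hxy ?_⟩
    have h1 : Real.cos x = Real.cos y := by
      simp only [cosC, ContinuousMap.coe_mk, Complex.ofReal_inj] at h0
      simpa using h0
    exact Subtype.ext (Real.injOn_cos x.2 y.2 h1)
  have hdense := ContinuousMap.starSubalgebra_topologicalClosure_eq_top_of_separatesPoints A hsep
  have hall : ∀ u : CPi, pairing f (toL2 (u * cosC a 0)) = 0 := fun u => by
    have hu : u ∈ closure (A : Set CPi) := by
      rw [← StarSubalgebra.topologicalClosure_coe, hdense]; trivial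
    refine closure_minimal (t := {u : CPi | pairing f (toL2 (u * cosC a 0)) = 0}) (fun w hw => ?_)
      ?_ hu
    · exact hM _ (hA w hw _ (Submodule.subset_span ⟨0, rfl⟩)).1
    · exact isClosed_eq (by fun_prop) continuous_const
  refine Lp_eq_zero_of_integral_mul_eq_zero f (fun x => ((Real.cos (a * x) : ℝ) : ℂ))
    (by fun_prop) (fun x hx => ?_) (fun u => ?_)
  · have : 0 < Real.cos (a * x) := by
      rcases ha with rfl | rfl
      · simp
      · exact Real.cos_pos_of_mem_Ioo ⟨by linarith [hx.1, Real.pi_pos], by linarith [hx.2]⟩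
    exact_mod_cast this.ne'
  · rw [← hall u, pairing_toL2]
    refine setIntegral_congr_fun measurableSet_Ioo fun x hx => ?_
    have hx' := Set.Ioo_subset_Icc_self hx
    simp only [extPi_of_mem _ hx', ContinuousMap.mul_apply, cosC, ContinuousMap.coe_mk,
      Nat.cast_zero, zero_add]
    ring

theorem inner_toL2 (u w : CPi) :
    inner ℂ (toL2 u) (toL2 w) = ∫ x in Set.Ioo 0 Real.pi, starRingEnd ℂ (extPi u x) * extPi w x := by
  rw [L2.inner_def]
  refine integral_congr_ae ?_
  filter_upwards [coeFn_toL2 u, coeFn_toL2 w] with x hx hy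
  rw [hx, hy]; simp [mul_comm]

theorem integral_cos_int {t : ℝ} (k : ℤ) (hk : t = k) (ht : t ≠ 0) :
    ∫ x in (0 : ℝ)..Real.pi, Real.cos (t * x) = 0 := by
  rw [intervalIntegral.integral_comp_mul_left _ ht, integral_cos, hk]
  simp [Real.sin_int_mul_pi]

theorem inner_cosC (a : ℝ) (ha : a = 0 ∨ a = 1 / 2) (n k : ℕ) :
    inner ℂ (toL2 (cosC a n)) (toL2 (cosC a k)) =
      if n = k then (if (n : ℝ) + a = 0 then (Real.pi : ℂ) else Real.pi / 2) else 0 := by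
  have h1 : inner ℂ (toL2 (cosC a n)) (toL2 (cosC a k)) =
      ((∫ x in (0 : ℝ)..Real.pi, (1 / 2 * Real.cos (((n : ℝ) - k) * x) +
        1 / 2 * Real.cos ((n + k + 2 * a) * x)) : ℝ) : ℂ) := by
    rw [inner_toL2, intervalIntegral.integral_of_le Real.pi_pos.le, integral_Ioc_eq_integral_Ioo,
      ← integral_complex_ofReal]
    refine setIntegral_congr_fun measurableSet_Ioo fun x hx => ?_
    have hx' := Set.Ioo_subset_Icc_self hx
    simp only [extPi_of_mem _ hx', cosC, ContinuousMap.coe_mk, Complex.conj_ofReal]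
    have e1 : ((n : ℝ) - k) * x = (n + a) * x - (k + a) * x := by ring
    have e2 : ((n : ℝ) + k + 2 * a) * x = (n + a) * x + (k + a) * x := by ring
    have : (1 / 2 * Real.cos (((n : ℝ) - k) * x) + 1 / 2 * Real.cos ((n + k + 2 * a) * x)) =
        Real.cos ((n + a) * x) * Real.cos ((k + a) * x) := by
      rw [e1, e2, Real.cos_add, Real.cos_sub]; ring
    rw [this]; push_cast; rfl
  have ii : ∀ t : ℝ, IntervalIntegrable (fun x => 1 / 2 * Real.cos (t * x)) volume 0 Real.pi :=
    fun t => (by fun_prop : Continuous fun x => 1 / 2 * Real.cos (t * x)).intervalIntegrable _ _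
  rw [h1, intervalIntegral.integral_add (ii _) (ii _), intervalIntegral.integral_const_mul,
    intervalIntegral.integral_const_mul]
  obtain ⟨s, hs⟩ : ∃ s : ℤ, (n : ℝ) + k + 2 * a = s := by
    rcases ha with rfl | rfl
    · exact ⟨n + k, by push_cast; ring⟩
    · exact ⟨n + k + 1, by push_cast; ring⟩
  have ha0 : 0 ≤ a := by rcases ha with rfl | rfl <;> norm_num
  have hn0 : (0 : ℝ) ≤ n := n.cast_nonneg
  have hk0 : (0 : ℝ) ≤ k := k.cast_nonneg
  split_ifs with hnk h0
  · subst hnk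
    have : (n : ℝ) + n + 2 * a = 0 := by linarith
    rw [this]; simp; ring
  · subst hnk
    have hpos : 0 < (n : ℝ) + a := lt_of_le_of_ne (by positivity) (Ne.symm h0)
    rw [integral_cos_int s hs (by linarith)]; simp; ring
  · rw [integral_cos_int s hs, integral_cos_int (n - k) (by push_cast; ring)]
    · simp
    · rw [sub_ne_zero]; exact_mod_cast hnk
    · intro h0
      exact hnk (by exact_mod_cast (by linarith : (n : ℝ) = k))

/-- The constant function has a different norm, hence n ≥ 1; finitely many vectors do not matter
later. -/
theorem exists_cos_hilbertBasis (a : ℝ) (ha : a = 0 ∨ a = 1 / 2) :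
    ∃ c : HilbertBasis ℕ ℂ (Lp ℂ 2 volPi), ∀ n, 1 ≤ n →
      (Real.sqrt (Real.pi / 2) : ℂ) • c n = toL2 (cosC a n) := by
  let κ : ℕ → ℝ := fun n => if (n : ℝ) + a = 0 then Real.sqrt Real.pi else Real.sqrt (Real.pi / 2)
  have hκ : ∀ n, 0 < κ n := fun n => by
    have := Real.pi_pos
    simp only [κ]; split_ifs <;> positivity
  let c : ℕ → Lp ℂ 2 volPi := fun n => ((κ n : ℂ))⁻¹ • toL2 (cosC a n)
  have hc : Orthonormal ℂ c := by
    rw [orthonormal_iff_ite]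
    intro n k
    simp only [c, inner_smul_left, inner_smul_right, inner_cosC a ha, map_inv₀, Complex.conj_ofReal]
    split_ifs with h1 h2
    · subst h1
      have : (κ n : ℂ) * κ n = Real.pi := by
        norm_cast; simp only [κ, h2, if_true]; exact Real.mul_self_sqrt Real.pi_pos.le
      have h0 : (κ n : ℂ) ≠ 0 := by exact_mod_cast (hκ n).ne'
      rw [← this]; field_simp
    · subst h1
      have : (κ n : ℂ) * κ n = Real.pi / 2 := by
        norm_cast; simp only [κ, h2, if_false]
        rw [Real.mul_self_sqrt (by have := Real.pi_pos; positivity)]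
      have h0 : (κ n : ℂ) ≠ 0 := by exact_mod_cast (hκ n).ne'
      rw [← this]; field_simp
    · simp
  refine ⟨HilbertBasis.mkOfOrthogonalEqBot hc ?_, fun n hn => ?_⟩
  · rw [Submodule.eq_bot_iff]
    intro f hf
    have : star f = 0 := eq_zero_of_cos_moments a ha (star f) fun n => by
      have h1 := Submodule.inner_left_of_mem_orthogonal
        (Submodule.subset_span (Set.mem_range_self n)) hf
      have h0 : (κ n : ℂ) ≠ 0 := by exact_mod_cast (hκ n).ne'
      simp only [c, inner_smul_right] at h1
      simpa [pairing, h0] using h1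
    rw [← star_star f, this]
    rw [← norm_eq_zero, norm_star_Lp, norm_zero]
  · have hne : (n : ℝ) + a ≠ 0 := by
      have : (1 : ℝ) ≤ n := by exact_mod_cast hn
      rcases ha with rfl | rfl <;> linarith
    have h0 : (κ n : ℂ) ≠ 0 := by exact_mod_cast (hκ n).ne'
    have h1 : κ n = Real.sqrt (Real.pi / 2) := by simp [κ, hne]
    simp only [HilbertBasis.coe_mkOfOrthogonalEqBot, c]
    rw [← h1, smul_smul, mul_inv_cancel₀ h0, one_smul]

end

/-! ### Bases of the product space and the limit matrix. -/

section

open MeasureTheory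

section PiBasis
variable {ι κ E : Type*} [Fintype κ] [NormedAddCommGroup E] [InnerProductSpace ℂ E]

open Classical in
theorem exists_piLp_hilbertBasis [CompleteSpace E] (c : κ → HilbertBasis ι ℂ E) :
    ∃ b : HilbertBasis (ι × κ) ℂ (PiLp 2 fun _ : κ => E),
      ∀ n k, b (n, k) = WithLp.toLp 2 (Pi.single k (c k n)) := by
  let v : ι × κ → PiLp 2 (fun _ : κ => E) := fun p => WithLp.toLp 2 (Pi.single p.2 (c p.2 p.1))
  have hin : ∀ p (y : PiLp 2 fun _ : κ => E), inner ℂ (v p) y = inner ℂ (c p.2 p.1) (y p.2) := by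
    intro p y
    rw [PiLp.inner_apply, Finset.sum_eq_single p.2]
    · simp [v]
    · intro k _ hk
      simp [v, hk]
    · simp
  have hv : Orthonormal ℂ v := by
    rw [orthonormal_iff_ite]
    rintro ⟨n, k⟩ ⟨n', k'⟩
    rw [hin]
    by_cases hk : k = k'
    · subst hk
      simp only [v, Pi.single_eq_same, Prod.mk.injEq, and_true]
      exact orthonormal_iff_ite.1 (c k).orthonormal n n'
    · simp [v, hk]
  refine ⟨HilbertBasis.mkOfOrthogonalEqBot hv ?_, fun n k => by simp [v]⟩
  rw [Submodule.eq_bot_iff]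
  intro y hy
  ext k
  have : (c k).repr (y k) = 0 := by
    ext n
    rw [(c k).repr_apply_apply, ← hin (n, k)]
    exact Submodule.inner_right_of_mem_orthogonal
      (Submodule.subset_span (Set.mem_range_self (n, k))) hy
  simpa using this

/-- The action of a matrix on `E ^ κ`. -/
def matAct (A : Matrix κ κ ℂ) : (PiLp 2 fun _ : κ => E) →L[ℂ] (PiLp 2 fun _ : κ => E) :=
  ((PiLp.continuousLinearEquiv 2 ℂ fun _ : κ => E).symm : (κ → E) →L[ℂ] _).comp
    ((ContinuousLinearMap.pi fun j => ∑ k, A j k • ContinuousLinearMap.proj k).comp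
      (PiLp.continuousLinearEquiv 2 ℂ fun _ : κ => E : _ →L[ℂ] (κ → E)))

theorem matAct_apply (A : Matrix κ κ ℂ) (y : PiLp 2 fun _ : κ => E) (j : κ) :
    matAct A y j = ∑ k, A j k • y k := by
  simp [matAct]

theorem matAct_matAct (A B : Matrix κ κ ℂ) (y : PiLp 2 fun _ : κ => E) :
    matAct A (matAct B y) = matAct (A * B) y := by
  ext j
  simp only [matAct_apply, Matrix.mul_apply, Finset.smul_sum, Finset.sum_smul, smul_smul]
  exact Finset.sum_comm

theorem matAct_one [DecidableEq κ] (y : PiLp 2 fun _ : κ => E) :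
    matAct (1 : Matrix κ κ ℂ) y = y := by
  ext j
  simp [matAct_apply, Matrix.one_apply]

/-- The action of an invertible matrix on `E ^ κ`. -/
def matActEquiv [DecidableEq κ] (A B : Matrix κ κ ℂ) (h : A * B = 1) :
    (PiLp 2 fun _ : κ => E) ≃L[ℂ] (PiLp 2 fun _ : κ => E) :=
  ContinuousLinearEquiv.equivOfInverse (matAct A) (matAct B)
    (fun y => by rw [matAct_matAct, mul_eq_one_comm.1 h, matAct_one])
    (fun y => by rw [matAct_matAct, h, matAct_one])

end PiBasis

/-- Supplies the unperturbed Riesz basis: each column k has its own cosine basis, and the matrix A,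
rescaled by the norm of the cosines, mixes the components. -/
theorem exists_base_hilbertBasis {m : ℕ} (a : Fin m → ℝ) (ha : ∀ k, a k = 0 ∨ a k = 1 / 2)
    (A : Matrix (Fin m) (Fin m) ℂ) (hA : IsUnit A) :
    ∃ (b : HilbertBasis (ℕ × Fin m) ℂ (HSpace m)) (T : HSpace m ≃L[ℂ] HSpace m),
      ∀ n k, 1 ≤ n → T (b (n, k)) = WithLp.toLp 2 fun j => A j k • toL2 (cosC (a k) n) := by
  classical
  choose c hc using fun k => exists_cos_hilbertBasis (a k) (ha k)
  obtain ⟨b, hb⟩ := exists_piLp_hilbertBasis c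
  obtain ⟨B, hAB⟩ := hA.exists_right_inv
  set s : ℂ := (Real.sqrt (Real.pi / 2) : ℂ) with hs
  have hs0 : s ≠ 0 := by
    rw [hs]
    have : Real.sqrt (Real.pi / 2) ≠ 0 := by have := Real.pi_pos; positivity
    exact_mod_cast this
  refine ⟨b, matActEquiv (s • A) (s⁻¹ • B) (by simp [hAB, smul_smul, hs0]), fun n k hn => ?_⟩
  change matAct (s • A) (b (n, k)) = _
  ext1 j
  rw [matAct_apply, hb, Finset.sum_eq_single k]
  · simp only [Pi.single_eq_same, Matrix.smul_apply, smul_eq_mul, ← hc k n hn, smul_smul]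
    rw [mul_comm]
  · intro l _ hl
    simp [hl]
  · simp

-- A kernel vector c gives the rational function c_{k₀} + ∑ c_k / (w - z_k), whose numerator has
-- degree less than m but vanishes at the m points h_j. So it is zero, and its values at the z_k are
-- nonzero multiples of c_k.
open Polynomial in
theorem isUnit_cauchy {m : ℕ} (h z : Fin m → ℂ) (hh : Function.Injective h) (k₀ : Fin m)
    (hz : ∀ k l, k ≠ k₀ → l ≠ k₀ → z k = z l → k = l) (hhz : ∀ j k, k ≠ k₀ → h j ≠ z k) :
    IsUnit (Matrix.of fun j k : Fin m => if k = k₀ then (1 : ℂ) else (h j - z k)⁻¹) := by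
  rw [← Matrix.mulVec_injective_iff_isUnit]
  let A : Matrix (Fin m) (Fin m) ℂ := Matrix.of fun j k => if k = k₀ then 1 else (h j - z k)⁻¹
  change Function.Injective A.mulVec
  intro c d hcd
  suffices ∀ c, A.mulVec c = 0 → c = 0 from
    sub_eq_zero.1 (this (c - d) (by rw [Matrix.mulVec_sub]; exact sub_eq_zero.2 hcd))
  clear c d hcd
  intro c hc
  let s := Finset.univ.erase k₀
  let p : ℂ[X] := C (c k₀) * ∏ l ∈ s, (X - C (z l)) +
    ∑ k ∈ s, C (c k) * ∏ l ∈ s.erase k, (X - C (z l))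
  have hs : s.card < m := by
    have := Finset.card_erase_lt_of_mem (Finset.mem_univ k₀)
    rwa [Finset.card_univ, Fintype.card_fin] at this
  have hdeg : ∀ t : Finset (Fin m), t ⊆ s → ∀ x : ℂ,
      (C x * ∏ l ∈ t, (X - C (z l))).degree < m := fun t ht x => by
    refine ((degree_mul_le _ _).trans (add_le_add_left degree_C_le _)).trans_lt ?_
    rw [zero_add, degree_prod]
    simp only [degree_X_sub_C, Finset.sum_const, nsmul_eq_mul, mul_one]
    exact_mod_cast (Finset.card_le_card ht).trans_lt hs
  have hp : p = 0 := by
    refine eq_zero_of_degree_lt_of_eval_index_eq_zero (s := Finset.univ) (v := h) hh.injOn ?_ ?_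
    · rw [Finset.card_univ, Fintype.card_fin]
      refine (degree_add_le _ _).trans_lt (max_lt (hdeg _ subset_rfl _) ?_)
      refine (degree_sum_le _ _).trans_lt ?_
      rw [Finset.sup_lt_iff (by exact WithBot.bot_lt_coe m)]
      exact fun k _ => hdeg _ (Finset.erase_subset _ _) _
    · intro j _
      have hj := congrFun hc j
      simp only [A, Matrix.mulVec, dotProduct, Matrix.of_apply, Pi.zero_apply] at hj
      rw [← Finset.add_sum_erase _ _ (Finset.mem_univ k₀)] at hj
      simp only [if_true, one_mul] at hj
      have hj2 : c k₀ + ∑ k ∈ s, (h j - z k)⁻¹ * c k = 0 := by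
        rw [← hj]; congr 1
        exact Finset.sum_congr rfl fun k hk => by rw [if_neg (Finset.ne_of_mem_erase hk)]
      simp only [p, eval_add, eval_mul, eval_C, eval_prod, eval_sub, eval_X, eval_finsetSum]
      rw [← zero_mul (∏ l ∈ s, (h j - z l)), ← hj2, add_mul, Finset.sum_mul]
      congr 1
      refine Finset.sum_congr rfl fun k hk => ?_
      rw [← Finset.mul_prod_erase s _ hk]
      have := sub_ne_zero.2 (hhz j k (Finset.ne_of_mem_erase hk))
      field_simp
  have hck : ∀ k, k ≠ k₀ → c k = 0 := fun k hk => by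
    have hks : k ∈ s := Finset.mem_erase.2 ⟨hk, Finset.mem_univ _⟩
    have h1 : p.eval (z k) = 0 := by rw [hp]; simp
    simp only [p, eval_add, eval_mul, eval_C, eval_prod, eval_sub, eval_X, eval_finsetSum] at h1
    rw [Finset.prod_eq_zero hks (sub_self _), mul_zero, zero_add,
      Finset.sum_eq_single k] at h1
    · refine (mul_eq_zero.1 h1).resolve_right (Finset.prod_ne_zero_iff.2 fun l hl => ?_)
      rw [sub_ne_zero]
      intro h2
      have h3 := Finset.mem_erase.1 hl
      exact h3.1 (hz l k (Finset.ne_of_mem_erase h3.2) hk h2.symm)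
    · intro l hl hlk
      rw [Finset.prod_eq_zero (Finset.mem_erase.2 ⟨hlk.symm, hks⟩) (sub_self _), mul_zero]
    · exact fun h => absurd hks h
  ext k
  by_cases hk : k = k₀
  · subst hk
    have hj := congrFun hc k
    simp only [A, Matrix.mulVec, dotProduct, Matrix.of_apply, Pi.zero_apply] at hj
    rw [Finset.sum_eq_single k] at hj
    · simpa using hj
    · intro l _ hl
      rw [hck l hl, mul_zero]
    · simp
  · exact hck k hk

end

/-! ### The transform ∫ f φ(·, μ) and its division by linear factors. -/

section

open MeasureTheory

/-- The derivative of `φ` in `x`. -/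
def dphi (h : ℂ) (x : ℝ) (μ : ℂ) : ℂ := -μ * sinq x μ + h * cosq x μ

theorem hasDerivAt_phi (h μ : ℂ) (x : ℝ) : HasDerivAt (fun x : ℝ => phi h x μ) (dphi h x μ) x := by
  simp only [phi_eq, dphi]
  exact (hasDerivAt_cosq μ x).add ((hasDerivAt_sinq μ x).const_mul h)

theorem hasDerivAt_dphi (h μ : ℂ) (x : ℝ) :
    HasDerivAt (fun x : ℝ => dphi h x μ) (-μ * phi h x μ) x := by
  simp only [phi_eq, dphi]
  convert! ((hasDerivAt_sinq μ x).const_mul (-μ)).add ((hasDerivAt_cosq μ x).const_mul h) using 1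
  ring

theorem continuous_dphi (h μ : ℂ) : Continuous fun x : ℝ => dphi h x μ :=
  continuous_iff_continuousAt.2 fun x => (hasDerivAt_dphi h μ x).continuousAt

theorem dphi_ne_zero {h : ℂ} {x : ℝ} {μ : ℂ} (h0 : phi h x μ = 0) : dphi h x μ ≠ 0 := by
  intro h1
  rw [phi_eq] at h0
  unfold dphi at h1
  have := cosq_sq_add x μ
  have h2 : (1 : ℂ) = 0 := by
    rw [← this]
    linear_combination cosq x μ * h0 - sinq x μ * h1
  exact one_ne_zero h2

/-- By parity in the root, any square root r of the parameter may replace the principal one. -/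
theorem cosq_sq (x : ℝ) (r : ℂ) : cosq x (r ^ 2) = Complex.cos (r * x) := by
  unfold cosq
  rcases sq_eq_sq_iff_eq_or_eq_neg.1 (csqrt_sq (r ^ 2)) with h | h <;> simp [h]

theorem sinq_sq (x : ℝ) {r : ℂ} (hr : r ≠ 0) : sinq x (r ^ 2) = Complex.sin (r * x) / r := by
  unfold sinq
  rw [if_neg (pow_ne_zero 2 hr)]
  rcases sq_eq_sq_iff_eq_or_eq_neg.1 (csqrt_sq (r ^ 2)) with h | h <;> simp [h]

/-- The transform `G(μ) = ∫ f φ(·, μ)`. -/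
def trans (f : Lp ℂ 2 volPi) (h μ : ℂ) : ℂ := pairing f (toL2 (phiC h μ))

theorem differentiable_trans (f : Lp ℂ 2 volPi) (h : ℂ) : Differentiable ℂ (trans f h) :=
  ((pairing f).comp toL2).differentiable.comp (differentiable_phiC h)

theorem pairing_toL2_mk (f : Lp ℂ 2 volPi) (w : ℝ → ℂ) (hw : Continuous w) :
    pairing f (toL2 ⟨fun x => w x, hw.comp continuous_subtype_val⟩) = ∫ x, f x * w x ∂volPi := by
  rw [pairing_toL2]
  refine setIntegral_congr_fun measurableSet_Ioo fun x hx => ?_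
  simp only [extPi_of_mem _ (Set.Ioo_subset_Icc_self hx), ContinuousMap.coe_mk]

theorem trans_eq (f : Lp ℂ 2 volPi) (h μ : ℂ) : trans f h μ = ∫ x, f x * phi h x μ ∂volPi :=
  pairing_toL2_mk f _ (continuous_phi h μ)

theorem trans_toL2_mk (w : ℝ → ℂ) (hw : Continuous w) (h μ : ℂ) :
    trans (toL2 ⟨fun x => w x, hw.comp continuous_subtype_val⟩) h μ =
      ∫ x, w x * phi h x μ ∂volPi := by
  rw [trans_eq]
  refine integral_congr_ae ?_
  filter_upwards [coeFn_toL2 ⟨fun x => w x, hw.comp continuous_subtype_val⟩,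
    ae_restrict_mem measurableSet_Ioo] with x hx hx'
  rw [hx, extPi_of_mem _ (Set.Ioo_subset_Icc_self hx')]
  rfl

theorem integrable_mul_continuous {g : ℝ → ℂ} (hg : Integrable g volPi) {w : ℝ → ℂ}
    (hw : Continuous w) : Integrable (fun x => g x * w x) volPi := by
  let u : CPi := ⟨fun x => w x, hw.comp continuous_subtype_val⟩
  have : Integrable (fun x => g x * extPi u x) volPi :=
    hg.mul_bdd (continuous_extPi u).aestronglyMeasurable (.of_forall (norm_extPi_le u))
  refine this.congr ?_
  filter_upwards [ae_restrict_mem measurableSet_Ioo] with x hx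
  rw [extPi_of_mem _ (Set.Ioo_subset_Icc_self hx)]
  rfl

theorem integrable_continuous {w : ℝ → ℂ} (hw : Continuous w) : Integrable w volPi := by
  simpa using integrable_mul_continuous (integrable_const (1 : ℂ)) hw

/-- The primitive of `g` on `(0, π)`. -/
def prim (g : ℝ → ℂ) (x : ℝ) : ℂ := ∫ t in (0 : ℝ)..x, (Set.Ioo 0 Real.pi).indicator g t

theorem continuous_prim {g : ℝ → ℂ} (hg : Integrable g volPi) : Continuous (prim g) :=
  intervalIntegral.continuous_primitive (fun _ _ =>
    ((integrable_indicator_iff measurableSet_Ioo).2 hg).intervalIntegrable) 0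

theorem prim_eq (g : ℝ → ℂ) {x : ℝ} (hx : 0 ≤ x) :
    prim g x = ∫ t, (Set.Iic x).indicator g t ∂volPi := by
  unfold prim
  rw [intervalIntegral.integral_of_le hx, ← integral_indicator measurableSet_Ioc,
    ← integral_indicator measurableSet_Ioo]
  congr 1
  ext t
  simp only [Set.indicator_apply, Set.mem_Ioc, Set.mem_Ioo, Set.mem_Iic]
  grind

theorem prim_pi (g : ℝ → ℂ) : prim g Real.pi = ∫ t, g t ∂volPi := by
  rw [prim_eq _ Real.pi_pos.le]
  refine setIntegral_congr_fun measurableSet_Ioo fun x hx => ?_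
  rw [Set.indicator_of_mem (by exact hx.2.le)]

/-- Integration by parts for a merely integrable g, by Fubini on the triangle t ≤ x. -/
theorem integral_deriv_mul_prim {g u u' : ℝ → ℂ} (hg : Integrable g volPi)
    (hu : ∀ x, HasDerivAt u (u' x) x) (hu' : Continuous u') :
    ∫ x, u' x * prim g x ∂volPi = ∫ t, g t * (u Real.pi - u t) ∂volPi := by
  have h1 : ∫ x, u' x * prim g x ∂volPi =
      ∫ x, ∫ t, ({p : ℝ × ℝ | p.2 ≤ p.1}.indicator fun p => u' p.1 * g p.2) (x, t)
        ∂volPi ∂volPi := by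
    refine setIntegral_congr_fun measurableSet_Ioo fun x hx => ?_
    simp only [prim_eq g hx.1.le]
    rw [← integral_const_mul]
    congr 1; ext t
    simp only [Set.indicator_apply, Set.mem_Iic, Set.mem_ofPred_eq]
    split_ifs <;> simp
  have h2 : ∫ t, g t * (u Real.pi - u t) ∂volPi =
      ∫ t, ∫ x, ({p : ℝ × ℝ | p.2 ≤ p.1}.indicator fun p => u' p.1 * g p.2) (x, t)
        ∂volPi ∂volPi := by
    refine setIntegral_congr_fun measurableSet_Ioo fun t ht => ?_
    have e1 : ∫ x in t..Real.pi, u' x = u Real.pi - u t :=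
      intervalIntegral.integral_eq_sub_of_hasDerivAt (fun x _ => hu x) (hu'.intervalIntegrable _ _)
    rw [← e1, intervalIntegral.integral_of_le ht.2.le, ← integral_const_mul,
      integral_Ioc_eq_integral_Ioo, ← integral_Ico_eq_integral_Ioo,
      ← integral_indicator measurableSet_Ico, ← integral_indicator measurableSet_Ioo]
    congr 1; ext x
    simp only [Set.indicator_apply, Set.mem_Ico, Set.mem_Ioo, Set.mem_ofPred_eq]
    have := ht.1
    grind
  rw [h1, h2]
  refine integral_integral_swap ?_
  exact ((integrable_continuous hu').mul_prod hg).indicator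
    (measurableSet_le measurable_snd measurable_fst)

theorem integral_eq_of_hasDerivAt {u u' : ℝ → ℂ} (hu : ∀ x, HasDerivAt u (u' x) x)
    (hu' : Continuous u') : ∫ x, u' x ∂volPi = u Real.pi - u 0 := by
  rw [← intervalIntegral.integral_eq_sub_of_hasDerivAt (fun x _ => hu x)
    (hu'.intervalIntegrable _ _), intervalIntegral.integral_of_le Real.pi_pos.le,
    integral_Ioc_eq_integral_Ioo]

/-- Division of a transform by a linear factor. -/
theorem exists_trans_div (f : Lp ℂ 2 volPi) (h a b : ℂ)
    (hab : trans f h a + b * phi h Real.pi a = 0) :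
    ∃ y : Lp ℂ 2 volPi, ∀ μ, trans f h μ + b * phi h Real.pi μ = (μ - a) * trans y h μ := by
  have hCf : Integrable (fun x => f x * cosq x a) volPi :=
    integrable_mul_continuous (integrable_Lp f) (continuous_cosq a)
  have hSf : Integrable (fun x => f x * sinq x a) volPi :=
    integrable_mul_continuous (integrable_Lp f) (continuous_sinq a)
  set P := prim fun x => f x * cosq x a with hP
  set Q := prim fun x => f x * sinq x a with hQ
  have cP : Continuous P := continuous_prim hCf
  have cQ : Continuous Q := continuous_prim hSf
  have cphi := continuous_phi h
  have cdphi := continuous_dphi h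
  have cC := continuous_cosq
  have cS := continuous_sinq
  -- Variation of constants: formally Y solves -Y'' - aY = f with Y(0) = c, Y'(0) = hc, and D c
  -- below is Y'(π).
  let Y : ℂ → ℝ → ℂ := fun c x => c * phi h x a - sinq x a * P x + cosq x a * Q x
  have cY : ∀ c, Continuous (Y c) := fun c => by
    have := cphi a; have := cC a; have := cS a
    fun_prop
  let D : ℂ → ℂ := fun c => c * dphi h Real.pi a - cosq Real.pi a * P Real.pi
    - a * sinq Real.pi a * Q Real.pi
  -- Green's identity for Y and φ(·, μ). Since f is only in L₂, the terms with P and Q are handled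
  -- by Fubini instead of differentiating Y twice.
  have main : ∀ c μ, trans f h μ = Y c Real.pi * dphi h Real.pi μ - D c * phi h Real.pi μ +
      (μ - a) * ∫ x, Y c x * phi h x μ ∂volPi := fun c μ => by
    have := cphi a; have := cC a; have := cS a; have := cphi μ; have := cdphi μ; have := cdphi a
    have i1 := integral_deriv_mul_prim hCf
      (u := fun x => -(sinq x a * dphi h x μ) + cosq x a * phi h x μ)
      (u' := fun x => (μ - a) * (sinq x a * phi h x μ)) (fun x => by
        convert! ((hasDerivAt_sinq a x).mul (hasDerivAt_dphi h μ x)).neg.add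
          ((hasDerivAt_cosq a x).mul (hasDerivAt_phi h μ x)) using 1
        ring) (by fun_prop)
    have i2 := integral_deriv_mul_prim hSf
      (u := fun x => cosq x a * dphi h x μ + a * (sinq x a * phi h x μ))
      (u' := fun x => (a - μ) * (cosq x a * phi h x μ)) (fun x => by
        convert! ((hasDerivAt_cosq a x).mul (hasDerivAt_dphi h μ x)).add
          (((hasDerivAt_sinq a x).mul (hasDerivAt_phi h μ x)).const_mul a) using 1
        ring) (by fun_prop)
    have i3 := integral_eq_of_hasDerivAt
      (u := fun x => phi h x a * dphi h x μ - dphi h x a * phi h x μ)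
      (u' := fun x => (a - μ) * (phi h x a * phi h x μ)) (fun x => by
        convert! ((hasDerivAt_phi h a x).mul (hasDerivAt_dphi h μ x)).sub
          ((hasDerivAt_dphi h a x).mul (hasDerivAt_phi h μ x)) using 1
        ring) (by fun_prop)
    have z0 : phi h 0 a * dphi h 0 μ - dphi h 0 a * phi h 0 μ = 0 := by
      simp [phi_eq, dphi]
    rw [z0, sub_zero] at i3
    have e1 : (μ - a) * ∫ x, Y c x * phi h x μ ∂volPi =
        -c * (∫ x, (a - μ) * (phi h x a * phi h x μ) ∂volPi)
        - (∫ x, (μ - a) * (sinq x a * phi h x μ) * P x ∂volPi)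
        - ∫ x, (a - μ) * (cosq x a * phi h x μ) * Q x ∂volPi := by
      rw [← integral_const_mul, ← integral_const_mul, ← integral_sub, ← integral_sub]
      · congr 1; ext x; simp only [Y]; ring
      all_goals first
        | exact integrable_continuous (by fun_prop)
    have e2 : ∀ (p q : ℝ → ℂ), Continuous p → Continuous q → ∀ k l : ℂ,
        (∫ x, f x * cosq x a * (k - p x) ∂volPi) + ∫ x, f x * sinq x a * (l - q x) ∂volPi =
        P Real.pi * k + Q Real.pi * l - ∫ x, f x * (cosq x a * p x + sinq x a * q x) ∂volPi := by
      intro p q hp hq k l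
      rw [hP, hQ, prim_pi, prim_pi, ← integral_mul_const, ← integral_mul_const, ← integral_add,
        ← integral_add, ← integral_sub]
      · congr 1; ext x; ring
      · exact (hCf.mul_const _).add (hSf.mul_const _)
      · exact integrable_mul_continuous (integrable_Lp f) (by fun_prop)
      · exact hCf.mul_const _
      · exact hSf.mul_const _
      · exact integrable_mul_continuous hCf (by fun_prop)
      · exact integrable_mul_continuous hSf (by fun_prop)
    have e3 := e2 (fun x => -(sinq x a * dphi h x μ) + cosq x a * phi h x μ)
      (fun x => cosq x a * dphi h x μ + a * (sinq x a * phi h x μ)) (by fun_prop) (by fun_prop)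
      (-(sinq Real.pi a * dphi h Real.pi μ) + cosq Real.pi a * phi h Real.pi μ)
      (cosq Real.pi a * dphi h Real.pi μ + a * (sinq Real.pi a * phi h Real.pi μ))
    have e4 : ∫ x, f x * (cosq x a * (-(sinq x a * dphi h x μ) + cosq x a * phi h x μ) +
        sinq x a * (cosq x a * dphi h x μ + a * (sinq x a * phi h x μ))) ∂volPi = trans f h μ := by
      rw [trans_eq]
      congr 1; ext x
      linear_combination f x * phi h x μ * cosq_sq_add x a
    rw [e4, ← i1, ← i2] at e3
    rw [e1, i3]
    simp only [Y, D]
    linear_combination e3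
  -- One free constant meets two boundary conditions: one is solved for c, and the other follows
  -- from Green's identity at μ = a together with `hab`.
  obtain ⟨c, hc1, hc2⟩ : ∃ c, Y c Real.pi = 0 ∧ D c = b := by
    by_cases h0 : phi h Real.pi a = 0
    · have h1 := dphi_ne_zero h0
      refine ⟨(b + cosq Real.pi a * P Real.pi + a * sinq Real.pi a * Q Real.pi) / dphi h Real.pi a,
        ?_, by simp only [D]; field_simp; ring⟩
      have := main ((b + cosq Real.pi a * P Real.pi + a * sinq Real.pi a * Q Real.pi) /
        dphi h Real.pi a) a
      rw [h0, mul_zero, add_zero] at hab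
      rw [hab, h0, sub_self, zero_mul, mul_zero, add_zero, sub_zero] at this
      exact (mul_eq_zero.1 this.symm).resolve_right h1
    · have hY : Y ((sinq Real.pi a * P Real.pi - cosq Real.pi a * Q Real.pi) / phi h Real.pi a)
          Real.pi = 0 := by simp only [Y]; field_simp; ring
      refine ⟨_, hY, ?_⟩
      have := main ((sinq Real.pi a * P Real.pi - cosq Real.pi a * Q Real.pi) / phi h Real.pi a) a
      rw [hY, sub_self, zero_mul, zero_mul, add_zero, zero_sub] at this
      have h2 : (b - D ((sinq Real.pi a * P Real.pi - cosq Real.pi a * Q Real.pi) /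
        phi h Real.pi a)) * phi h Real.pi a = 0 := by linear_combination hab - this
      exact (sub_eq_zero.1 ((mul_eq_zero.1 h2).resolve_right h0)).symm
  refine ⟨toL2 ⟨fun x => Y c x, (cY c).comp continuous_subtype_val⟩, fun μ => ?_⟩
  rw [trans_toL2_mk _ (cY c), main c μ, hc1, hc2]
  ring

end

/-! ### Injectivity of the transform and its decay along μ = n². -/

section

open MeasureTheory

theorem trans_add (f f' : Lp ℂ 2 volPi) (h μ : ℂ) :
    trans (f + f') h μ = trans f h μ + trans f' h μ := pairing_add _ _ _

theorem trans_smul (c : ℂ) (f : Lp ℂ 2 volPi) (h μ : ℂ) :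
    trans (c • f) h μ = c * trans f h μ := pairing_smul _ _ _

theorem eq_zero_of_integral_cosq (f : Lp ℂ 2 volPi)
    (H : ∀ μ, ∫ x, f x * cosq x μ ∂volPi = 0) : f = 0 := by
  refine eq_zero_of_cos_moments 0 (Or.inl rfl) f fun n => ?_
  rw [← H ((n : ℂ) ^ 2), ← pairing_toL2_mk f _ (continuous_cosq _)]
  congr 2
  ext x
  simp [cosC, cosq_sq]

/-- With W(x) = ∫_x^π f the transform of f is the cosine transform of f + hW. Hence f = -hW, a
Volterra equation: W' = hW with W(π) = 0, so W = 0. -/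
theorem eq_zero_of_trans_eq_zero (f : Lp ℂ 2 volPi) (h : ℂ) (H : ∀ μ, trans f h μ = 0) :
    f = 0 := by
  set F := prim f Real.pi with hF
  have cP : Continuous (prim f) := continuous_prim (integrable_Lp f)
  have cW : Continuous fun x => F - prim f x := by fun_prop
  let W : Lp ℂ 2 volPi := toL2 ⟨fun x => F - prim f x, cW.comp continuous_subtype_val⟩
  have hW : ∀ᵐ x ∂volPi, W x = F - prim f x := by
    filter_upwards [coeFn_toL2 ⟨fun x => F - prim f x, cW.comp continuous_subtype_val⟩,
      ae_restrict_mem measurableSet_Ioo] with x hx hx'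
    rw [hx, extPi_of_mem _ (Set.Ioo_subset_Icc_self hx')]
    rfl
  have h1 : f + h • W = 0 := by
    refine eq_zero_of_integral_cosq _ fun μ => ?_
    have cS := continuous_sinq μ
    have cC := continuous_cosq μ
    have i1 := integral_deriv_mul_prim (integrable_Lp f) (hasDerivAt_sinq μ) cC
    have i2 := integral_eq_of_hasDerivAt (hasDerivAt_sinq μ) cC
    have i3 := H μ
    simp only [trans_eq, phi_eq] at i3
    have e1 : ∫ x, (f + h • W : Lp ℂ 2 volPi) x * cosq x μ ∂volPi =
        ∫ x, (f x * cosq x μ + h * (F * cosq x μ - cosq x μ * prim f x)) ∂volPi := by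
      refine integral_congr_ae ?_
      filter_upwards [hW, Lp.coeFn_add f (h • W), Lp.coeFn_smul h W] with x h1 h2 h3
      simp only [h2, Pi.add_apply, h3, Pi.smul_apply, h1, smul_eq_mul]
      ring
    have i4 : ∫ x, f x * (cosq x μ + h * sinq x μ) ∂volPi =
        ∫ x, (f x * cosq x μ + h * (f x * sinq x μ)) ∂volPi := by
      congr 1; ext x; ring
    have f1 := integrable_mul_continuous (integrable_Lp f) cC
    have f2 := integrable_mul_continuous (integrable_Lp f) cS
    rw [i4, integral_add f1 (f2.const_mul _), integral_const_mul] at i3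
    simp only [mul_sub] at i1
    rw [integral_sub ((integrable_Lp f).mul_const _) f2, integral_mul_const, ← prim_pi f, ← hF] at i1
    rw [e1, integral_add f1 (integrable_continuous (by fun_prop)), integral_const_mul,
      integral_sub (integrable_continuous (by fun_prop)) (integrable_continuous (by fun_prop)),
      integral_const_mul, i2, i1, sinq_zero_left]
    linear_combination i3
  have h2 : ∀ᵐ x ∂volPi, f x = -h * (F - prim f x) := by
    filter_upwards [hW, Lp.coeFn_add f (h • W), Lp.coeFn_smul h W, Lp.coeFn_zero ℂ 2 volPi]
      with x e1 e2 e3 e4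
    have : (f + h • W : Lp ℂ 2 volPi) x = 0 := by rw [h1, e4]; rfl
    rw [e2, Pi.add_apply, e3, Pi.smul_apply, e1, smul_eq_mul] at this
    linear_combination this
  have h3 : ∀ x ∈ Set.Icc 0 Real.pi, prim f x = ∫ t in (0 : ℝ)..x, -h * (F - prim f t) := by
    intro x hx
    rw [prim_eq _ hx.1, intervalIntegral.integral_of_le hx.1, integral_Ioc_eq_integral_Ioo,
      ← integral_indicator measurableSet_Ioo, ← integral_indicator measurableSet_Ioo]
    rw [ae_restrict_iff' measurableSet_Ioo] at h2
    refine integral_congr_ae ?_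
    filter_upwards [h2, (measure_eq_zero_iff_ae_notMem (μ := volume) (s := {x})).1 (by simp)]
      with t ht htx
    have htx' : t ≠ x := htx
    have := hx.2
    simp only [Set.indicator_apply, Set.mem_Ioo, Set.mem_Iic]
    by_cases h0 : 0 < t ∧ t < x
    · rw [if_pos ⟨h0.1, h0.2.trans_le this⟩, if_pos h0.2.le, if_pos h0,
        ht ⟨h0.1, h0.2.trans_le this⟩]
    · grind
  -- A version of W that is differentiable everywhere and equals W on [0, π].
  let V : ℝ → ℂ := fun x => F - ∫ t in (0 : ℝ)..x, -h * (F - prim f t)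
  have hV : ∀ x, HasDerivAt V (h * (F - prim f x)) x := fun x => by
    have hc : Continuous fun t => -h * (F - prim f t) := by fun_prop
    have := (intervalIntegral.integral_hasDerivAt_right (a := 0) (b := x)
      (hc.intervalIntegrable _ _) (hc.stronglyMeasurableAtFilter _ _) hc.continuousAt).const_sub F
    convert! this using 1
    ring
  have hVW : ∀ x ∈ Set.Icc 0 Real.pi, V x = F - prim f x := fun x hx => by
    simp only [V]; rw [← h3 x hx]
  have hE : ∀ x : ℝ, HasDerivAt (fun x : ℝ => Complex.exp (-h * x)) (Complex.exp (-h * x) * -h) x :=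
    fun x => by
      have := (Complex.ofRealCLM.hasDerivAt (x := x)).const_mul (-h)
      simpa using this.cexp
  have hconst : ∀ x ∈ Set.Icc 0 Real.pi, V x * Complex.exp (-h * x) =
      V 0 * Complex.exp (-h * (0 : ℝ)) := by
    refine constant_of_has_deriv_right_zero (f := fun x : ℝ => V x * Complex.exp (-h * x))
      (fun x _ => ((hV x).mul (hE x)).continuousAt.continuousWithinAt) fun x hx => ?_
    have := ((hV x).mul (hE x)).hasDerivWithinAt (s := Set.Ici x)
    convert! this using 1
    rw [hVW x (Set.Ico_subset_Icc_self hx)]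
    ring
  have hV0 : ∀ x ∈ Set.Icc 0 Real.pi, V x = 0 := fun x hx => by
    have hp := hconst Real.pi ⟨Real.pi_pos.le, le_rfl⟩
    rw [← hconst x hx, hVW Real.pi ⟨Real.pi_pos.le, le_rfl⟩, hF, sub_self, zero_mul] at hp
    exact (mul_eq_zero.1 hp.symm).resolve_right (Complex.exp_ne_zero _)
  refine Lp.ext ?_
  filter_upwards [h2, Lp.coeFn_zero ℂ 2 volPi, ae_restrict_mem measurableSet_Ioo] with x e1 e2 e3
  have hx := Set.Ioo_subset_Icc_self e3
  rw [e1, e2, ← hVW x hx, hV0 x hx]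
  simp

-- Bessel's inequality handles the cosine part; the sine part carries a factor h/n.
open Filter Topology in
theorem tendsto_trans_sq (f : Lp ℂ 2 volPi) (h : ℂ) :
    Tendsto (fun n : ℕ => trans f h ((n : ℂ) ^ 2)) atTop (𝓝 0) := by
  obtain ⟨c, hc⟩ := exists_cos_hilbertBasis 0 (Or.inl rfl)
  have h1 : Tendsto (fun n : ℕ => pairing f (toL2 (cosC 0 n))) atTop (𝓝 0) := by
    have hs := (c.orthonormal.inner_products_summable (x := star f)).tendsto_atTop_zero
    have hs2 : Tendsto (fun n => ‖inner ℂ (c n) (star f)‖) atTop (𝓝 0) := by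
      have := (Real.continuous_sqrt.tendsto 0).comp hs
      simpa [Function.comp_def] using this
    have hs3 : Tendsto (fun n => pairing f (c n)) atTop (𝓝 0) := by
      rw [tendsto_zero_iff_norm_tendsto_zero]
      refine hs2.congr fun n => ?_
      rw [pairing, innerSL_apply_apply, norm_inner_symm]
    have hs4 := hs3.const_mul (Real.sqrt (Real.pi / 2) : ℂ)
    rw [mul_zero] at hs4
    refine hs4.congr' ?_
    filter_upwards [eventually_ge_atTop 1] with n hn
    rw [← hc n hn, map_smul, smul_eq_mul]
  let sn : ℕ → CPi := fun n => ⟨fun x => Complex.sin (n * ((x : ℝ) : ℂ)), by fun_prop⟩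
  have hsn : ∀ n, ‖sn n‖ ≤ 1 := fun n => (ContinuousMap.norm_le _ zero_le_one).2 fun x => by
    have : Complex.sin (n * ((x : ℝ) : ℂ)) = ((Real.sin (n * x) : ℝ) : ℂ) := by push_cast; rfl
    simp only [sn, ContinuousMap.coe_mk, this, Complex.norm_real]
    exact Real.abs_sin_le_one _
  have h2 : Tendsto (fun n : ℕ => (h * (n : ℂ)⁻¹) * pairing f (toL2 (sn n))) atTop (𝓝 0) := by
    have hb : IsBoundedUnder (· ≤ ·) atTop (norm ∘ fun n => pairing f (toL2 (sn n))) := by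
      refine isBoundedUnder_of ⟨‖(pairing f).comp toL2‖, fun n => ?_⟩
      simpa using ((pairing f).comp toL2).unit_le_opNorm _ (hsn n)
    have hz : Tendsto (fun n : ℕ => h * (n : ℂ)⁻¹) atTop (𝓝 0) := by
      have := (tendsto_inv_atTop_nhds_zero_nat (𝕜 := ℂ)).const_mul h
      simpa using this
    exact hz.zero_mul_isBoundedUnder_le hb
  have h3 := h1.add h2
  rw [add_zero] at h3
  refine h3.congr' ?_
  filter_upwards [eventually_ge_atTop 1] with n hn
  have hn0 : (n : ℂ) ≠ 0 := by exact_mod_cast (by omega : n ≠ 0)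
  have : phiC h ((n : ℂ) ^ 2) = cosC 0 n + (h * (n : ℂ)⁻¹) • sn n := by
    ext x
    simp only [phiC, ContinuousMap.coe_mk, phi_eq, cosq_sq, sinq_sq _ hn0, cosC, sn,
      ContinuousMap.add_apply, ContinuousMap.smul_apply, smul_eq_mul]
    push_cast
    rw [add_zero]
    ring
  rw [trans, this, map_add, map_smul, map_add, map_smul, smul_eq_mul]

end

/-! ### The characteristic function F_f and its null space. -/

section

open MeasureTheory

theorem eq_of_phi_eq_zero {h₁ h₂ : ℂ} {x : ℝ} {μ : ℂ} (e₁ : phi h₁ x μ = 0) (e₂ : phi h₂ x μ = 0) :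
    h₁ = h₂ := by
  rw [phi_eq] at e₁ e₂
  have h3 : (h₁ - h₂) * sinq x μ = 0 := by linear_combination e₁ - e₂
  rcases mul_eq_zero.1 h3 with h4 | h4
  · exact sub_eq_zero.1 h4
  · have := cosq_sq_add x μ
    have e : cosq x μ = 0 := by simpa [h4] using e₁
    simp [h4, e] at this

theorem cos_natCast_mul_pi (n : ℕ) : Complex.cos (n * Real.pi) = (-1) ^ n := by
  exact_mod_cast congrArg (fun r : ℝ => (r : ℂ)) (Real.cos_nat_mul_pi n)

theorem phi_pi_sq (h : ℂ) {n : ℕ} (hn : n ≠ 0) : phi h Real.pi ((n : ℂ) ^ 2) = (-1) ^ n := by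
  rw [phi_eq, cosq_sq, sinq_sq _ (by exact_mod_cast hn)]
  have h1 : Complex.sin (n * Real.pi) = 0 := Complex.sin_nat_mul_pi n
  rw [h1, cos_natCast_mul_pi]; simp

/-- Used to cancel polynomial factors in identities between entire functions. -/
theorem eq_zero_of_mul_eq_zero_off_finite {g p : ℂ → ℂ} (hg : Continuous g) {s : Set ℂ}
    (hs : s.Finite) (hp : ∀ μ ∉ s, p μ ≠ 0) (H : ∀ μ, p μ * g μ = 0) (μ : ℂ) : g μ = 0 := by
  have hd : Dense sᶜ := hs.countable.dense_compl ℂ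
  have : g = fun _ => 0 := hg.ext_on hd continuous_const fun μ hμ =>
    (mul_eq_zero.1 (H μ)).resolve_left (hp μ hμ)
  exact congrFun this μ

variable {m : ℕ}

/-- The entire function `∑ⱼ (∏_{i ≠ j} φᵢ(π, μ)) ∫ fⱼ φⱼ(·, μ)`. -/
def charF (h : Fin m → ℂ) (f : HSpace m) (μ : ℂ) : ℂ :=
  ∑ j, (∏ i ∈ Finset.univ.erase j, phi (h i) Real.pi μ) * trans (f j) (h j) μ

theorem differentiable_charF (h : Fin m → ℂ) (f : HSpace m) : Differentiable ℂ (charF h f) := by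
  unfold charF
  refine Differentiable.fun_sum fun j _ => ?_
  refine Differentiable.mul ?_ (differentiable_trans _ _)
  exact Differentiable.fun_finsetProd fun i _ => differentiable_phi_pi (h i)

theorem charF_add (h : Fin m → ℂ) (f g : HSpace m) (μ : ℂ) :
    charF h (f + g) μ = charF h f μ + charF h g μ := by
  simp only [charF, PiLp.add_apply, trans_add, mul_add, Finset.sum_add_distrib]

theorem charF_smul (h : Fin m → ℂ) (c : ℂ) (f : HSpace m) (μ : ℂ) :
    charF h (c • f) μ = c * charF h f μ := by
  simp only [charF, PiLp.smul_apply, trans_smul, Finset.mul_sum]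
  exact Finset.sum_congr rfl fun j _ => by ring

/-- `charF` as a linear functional. -/
def charL (h : Fin m → ℂ) (μ : ℂ) : HSpace m →ₗ[ℂ] ℂ where
  toFun f := charF h f μ
  map_add' f g := charF_add h f g μ
  map_smul' c f := charF_smul h c f μ

/-- Replacing each G_j by G_j + b_j φ_j(π, ·) adds (∑ b_j) ∏ φ_i(π, ·) = 0 to F_f, so the components
may be corrected to vanish at a and then divided one by one. -/
theorem exists_charF_div_of (h : Fin m → ℂ) (f : HSpace m) (a : ℂ) (b : Fin m → ℂ)
    (hb : ∑ j, b j = 0) (hab : ∀ j, trans (f j) (h j) a + b j * phi (h j) Real.pi a = 0) :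
    ∃ y : HSpace m, (∀ j μ, trans (f j) (h j) μ + b j * phi (h j) Real.pi μ =
      (μ - a) * trans (y j) (h j) μ) ∧ ∀ μ, charF h f μ = (μ - a) * charF h y μ := by
  choose y hy using fun j => exists_trans_div (f j) (h j) a (b j) (hab j)
  refine ⟨WithLp.toLp 2 y, hy, fun μ => ?_⟩
  simp only [charF, Finset.mul_sum]
  have : ∀ j, (μ - a) * ((∏ i ∈ Finset.univ.erase j, phi (h i) Real.pi μ) * trans (y j) (h j) μ) =
      (∏ i ∈ Finset.univ.erase j, phi (h i) Real.pi μ) * trans (f j) (h j) μ +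
        b j * ∏ i, phi (h i) Real.pi μ := fun j => by
    rw [← Finset.mul_prod_erase _ _ (Finset.mem_univ j)]
    linear_combination -(∏ i ∈ Finset.univ.erase j, phi (h i) Real.pi μ) * hy j μ
  simp only [this, Finset.sum_add_distrib]
  rw [← Finset.sum_mul, hb, zero_mul, add_zero]

/-- If no φ_j(π, a) vanishes, the corrections b_j are forced and ∑ b_j = 0 amounts to F_f(a) = 0. If
φ_s(π, a) = 0, then F_f(a) = 0 gives G_s(a) = 0, and b_s is free to make the sum zero. -/
theorem exists_charF_div (h : Fin m → ℂ) (hh : Function.Injective h) (f : HSpace m) (a : ℂ)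
    (hf : charF h f a = 0) : ∃ y : HSpace m, ∀ μ, charF h f μ = (μ - a) * charF h y μ := by
  by_cases hs : ∃ s, phi (h s) Real.pi a = 0
  · obtain ⟨s, hs⟩ := hs
    have hne : ∀ j, j ≠ s → phi (h j) Real.pi a ≠ 0 := fun j hj h0 =>
      hj (hh (eq_of_phi_eq_zero h0 hs))
    have hG : trans (f s) (h s) a = 0 := by
      unfold charF at hf
      rw [Finset.sum_eq_single s] at hf
      · refine (mul_eq_zero.1 hf).resolve_left (Finset.prod_ne_zero_iff.2 fun i hi => ?_)
        exact hne i (Finset.ne_of_mem_erase hi)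
      · intro j _ hj
        rw [Finset.prod_eq_zero (Finset.mem_erase.2 ⟨hj.symm, Finset.mem_univ _⟩) hs, zero_mul]
      · simp
    let c : Fin m → ℂ := fun j => -trans (f j) (h j) a / phi (h j) Real.pi a
    obtain ⟨y, -, hy⟩ := exists_charF_div_of h f a
      (fun j => if j = s then -∑ i ∈ Finset.univ.erase s, c i else c j) (by
        rw [← Finset.add_sum_erase _ _ (Finset.mem_univ s), if_pos rfl,
          Finset.sum_congr rfl fun j hj => if_neg (Finset.ne_of_mem_erase hj)]
        ring) (fun j => by
        by_cases hj : j = s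
        · subst hj; rw [hG, hs]; ring
        · rw [if_neg hj]; have := hne j hj; simp only [c]; field_simp; ring)
    exact ⟨y, hy⟩
  · push Not at hs
    obtain ⟨y, -, hy⟩ := exists_charF_div_of h f a
      (fun j => -trans (f j) (h j) a / phi (h j) Real.pi a) (by
        have h1 : charF h f a = (∏ i, phi (h i) Real.pi a) *
            ∑ j, trans (f j) (h j) a / phi (h j) Real.pi a := by
          rw [charF, Finset.mul_sum]
          refine Finset.sum_congr rfl fun j _ => ?_
          rw [← Finset.mul_prod_erase _ _ (Finset.mem_univ j)]
          have := hs j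
          field_simp
        rw [h1] at hf
        have h2 := (mul_eq_zero.1 hf).resolve_left (Finset.prod_ne_zero_iff.2 fun i _ => hs i)
        simp only [neg_div, Finset.sum_neg_distrib, h2, neg_zero])
      (fun j => by have := hs j; field_simp; ring)
    exact ⟨y, hy⟩

/-- The functions with vanishing transform. -/
def nullF (h : Fin m → ℂ) : Submodule ℂ (HSpace m) := ⨅ μ, LinearMap.ker (charL h μ)

theorem mem_nullF {h : Fin m → ℂ} {f : HSpace m} : f ∈ nullF h ↔ ∀ μ, charF h f μ = 0 := by
  simp [nullF, charL]

/-- Division by μ - 1 maps the null space to itself, and finite dimension would provide an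
eigenvector of it. -/
theorem nullF_eq_bot (h : Fin m → ℂ) (hh : Function.Injective h)
    [FiniteDimensional ℂ (nullF h)] : nullF h = ⊥ := by
  by_contra hne
  -- At μ = 1 all φ_j(π, μ) equal -1, so the corrections are b_j = G_j(1), linear in f, and F_f(1) =
  -- 0 says that they sum to zero.
  have hphi1 : ∀ j, phi (h j) Real.pi 1 = -1 := fun j => by
    simpa using phi_pi_sq (h j) one_ne_zero
  have hsum : ∀ f ∈ nullF h, ∑ j, trans (f j) (h j) 1 = 0 := fun f hf => by
    have h1 := mem_nullF.1 hf 1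
    simp only [charF, hphi1, Finset.prod_const, Finset.card_erase_of_mem (Finset.mem_univ _),
      ← Finset.mul_sum] at h1
    exact (mul_eq_zero.1 h1).resolve_left (by simp)
  have hex : ∀ f : nullF h, ∃ y : nullF h, ∀ j μ,
      trans (f.1 j) (h j) μ + trans (f.1 j) (h j) 1 * phi (h j) Real.pi μ =
        (μ - 1) * trans (y.1 j) (h j) μ := fun f => by
    obtain ⟨y, hy1, hy2⟩ := exists_charF_div_of h f.1 1 (fun j => trans (f.1 j) (h j) 1)
      (hsum f.1 f.2) (fun j => by rw [hphi1]; ring)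
    refine ⟨⟨y, mem_nullF.2 ?_⟩, hy1⟩
    refine eq_zero_of_mul_eq_zero_off_finite (differentiable_charF h y).continuous
      (Set.finite_singleton 1) (p := fun μ => μ - 1) (fun μ hμ => sub_ne_zero.2 hμ) fun μ => ?_
    rw [← hy2, mem_nullF.1 f.2]
  -- The quotient is unique by injectivity of the transform; this makes the chosen map linear.
  have huniq : ∀ y y' : HSpace m, (∀ j μ, (μ - 1) * trans (y j) (h j) μ =
      (μ - 1) * trans (y' j) (h j) μ) → y = y' := fun y y' H => by
    ext1 j
    refine sub_eq_zero.1 (eq_zero_of_trans_eq_zero _ (h j) ?_)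
    refine eq_zero_of_mul_eq_zero_off_finite (differentiable_trans _ _).continuous
      (Set.finite_singleton 1) (p := fun μ => μ - 1) (fun μ hμ => sub_ne_zero.2 hμ) fun μ => ?_
    have h1 : trans (y j - y' j) (h j) μ = trans (y j) (h j) μ - trans (y' j) (h j) μ := by
      have := trans_add (y j - y' j) (y' j) (h j) μ
      rw [sub_add_cancel] at this
      linear_combination -this
    rw [h1]
    linear_combination H j μ
  choose R hR using hex
  let L : nullF h →ₗ[ℂ] nullF h :=
    { toFun := R
      map_add' := fun f g => Subtype.ext (huniq _ _ fun j μ => by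
        rw [← hR]
        simp only [Submodule.coe_add, PiLp.add_apply, trans_add, mul_add]
        rw [← hR, ← hR]; ring)
      map_smul' := fun c f => Subtype.ext (huniq _ _ fun j μ => by
        rw [← hR]
        simp only [Submodule.coe_smul, PiLp.smul_apply, trans_smul, RingHom.id_apply]
        rw [mul_left_comm, ← hR]; ring) }
  have : Nontrivial (nullF h) := (Submodule.nontrivial_iff_ne_bot).2 hne
  obtain ⟨α, hα⟩ := Module.End.exists_eigenvalue L
  obtain ⟨f, hf⟩ := hα.exists_hasEigenvector
  have hfe : R f = α • f := hf.apply_eq_smul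
  have key : ∀ j μ, trans (f.1 j) (h j) μ + trans (f.1 j) (h j) 1 * phi (h j) Real.pi μ =
      (μ - 1) * (α * trans (f.1 j) (h j) μ) := fun j μ => by
    rw [hR, hfe, ← trans_smul α]; rfl
  -- If α = 0, then G_j = -b_j φ_j(π, ·) has modulus |b_j| at μ = n², against the decay. If α ≠ 0,
  -- at μ = 1 + 1/α the G_j cancel and b_j φ_j(π, μ) = 0 for all j; at most one φ_j vanishes there,
  -- and ∑ b_j = 0 settles that index.
  have hb : ∀ j, trans (f.1 j) (h j) 1 = 0 := by
    by_cases h0 : α = 0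
    · intro j
      have h1 := tendsto_trans_sq (f.1 j) (h j)
      rw [tendsto_zero_iff_norm_tendsto_zero] at h1
      have h2 : Filter.Tendsto (fun _ : ℕ => ‖trans (f.1 j) (h j) 1‖) Filter.atTop (nhds 0) := by
        refine h1.congr' ?_
        filter_upwards [Filter.eventually_ge_atTop 1] with n hn
        have h3 := key j ((n : ℂ) ^ 2)
        rw [h0, zero_mul, mul_zero, phi_pi_sq _ (by omega)] at h3
        rw [eq_neg_of_add_eq_zero_left h3]
        simp
      exact norm_eq_zero.1 (tendsto_nhds_unique tendsto_const_nhds h2)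
    · have h1 : ∀ j, trans (f.1 j) (h j) 1 * phi (h j) Real.pi (1 + α⁻¹) = 0 := fun j => by
        have h2 := key j (1 + α⁻¹)
        rw [add_sub_cancel_left, inv_mul_cancel_left₀ h0] at h2
        linear_combination h2
      by_cases hs : ∃ s, phi (h s) Real.pi (1 + α⁻¹) = 0
      · obtain ⟨s, hs⟩ := hs
        have h2 : ∀ j, j ≠ s → trans (f.1 j) (h j) 1 = 0 := fun j hj =>
          (mul_eq_zero.1 (h1 j)).resolve_right fun h3 => hj (hh (eq_of_phi_eq_zero h3 hs))
        have h3 := hsum f.1 f.2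
        rw [Finset.sum_eq_single s (fun j _ hj => h2 j hj) (by simp)] at h3
        intro j
        by_cases hj : j = s
        · rw [hj]; exact h3
        · exact h2 j hj
      · push Not at hs
        exact fun j => (mul_eq_zero.1 (h1 j)).resolve_right (hs j)
  refine hf.2 (Subtype.ext ?_)
  ext1 j
  refine eq_zero_of_trans_eq_zero _ (h j) ?_
  have hfin : {μ : ℂ | 1 - (μ - 1) * α = 0}.Finite := by
    refine Set.Subsingleton.finite fun μ hμ ν hν => ?_
    simp only [Set.mem_ofPred_eq] at hμ hν
    have h0 : α ≠ 0 := fun h0 => by simp [h0] at hμ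
    have : (μ - ν) * α = 0 := by linear_combination hν - hμ
    exact sub_eq_zero.1 ((mul_eq_zero.1 this).resolve_right h0)
  refine eq_zero_of_mul_eq_zero_off_finite (differentiable_trans _ _).continuous hfin
    (p := fun μ => 1 - (μ - 1) * α) (fun μ hμ => hμ) fun μ => ?_
  have := key j μ
  rw [hb j] at this
  linear_combination this

end

/-! ### Simple zeros, and chains as orders of vanishing. -/

section

open MeasureTheory

theorem clm_iteratedDeriv {E F : Type*} [NormedAddCommGroup E] [NormedSpace ℂ E]
    [NormedAddCommGroup F] [NormedSpace ℂ F] [CompleteSpace E] (L : E →L[ℂ] F) {f : ℂ → E} {z : ℂ}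
    (hf : AnalyticAt ℂ f z) (ν : ℕ) :
    iteratedDeriv ν (fun μ => L (f μ)) z = L (iteratedDeriv ν f z) := by
  have h1 : ContDiffAt ℂ ν f z := hf.contDiffAt
  have := L.iteratedFDeriv_comp_left h1 (i := ν) le_rfl
  simp only [iteratedDeriv_eq_iteratedFDeriv]
  have h2 : (fun μ => L (f μ)) = L ∘ f := rfl
  rw [h2, this]
  rfl

/-- By Green's identity a double zero a would give ∫ φ(x, a)² dx = 0. An energy identity turns this
into π(h² + a) + h = 0, and with φ(π, a) = 0 this places h in the exceptional set through ρ = 2π√a.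
-/
theorem deriv_phi_pi_ne_zero {h : ℂ} (hh : h ∉ exceptionalSet) {a : ℂ}
    (h0 : phi h Real.pi a = 0) : deriv (phi h Real.pi) a ≠ 0 := by
  intro hd
  have cphi := continuous_phi h
  have cdphi := continuous_dphi h
  let T : ℂ → ℂ := trans (toL2 (phiC h a)) h
  have hT : ∀ μ, T μ = ∫ x, phi h x a * phi h x μ ∂volPi := fun μ => trans_toL2_mk _ (cphi a) h μ
  have e1 : ∀ μ, (μ - a) * T μ = dphi h Real.pi a * phi h Real.pi μ := fun μ => by
    have := cphi a; have := cphi μ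
    have i3 := integral_eq_of_hasDerivAt
      (u := fun x => phi h x a * dphi h x μ - dphi h x a * phi h x μ)
      (u' := fun x => (a - μ) * (phi h x a * phi h x μ)) (fun x => by
        convert! ((hasDerivAt_phi h a x).mul (hasDerivAt_dphi h μ x)).sub
          ((hasDerivAt_dphi h a x).mul (hasDerivAt_phi h μ x)) using 1
        ring) (by fun_prop)
    have z0 : phi h 0 a * dphi h 0 μ - dphi h 0 a * phi h 0 μ = 0 := by
      simp [phi_eq, dphi]
    rw [z0, sub_zero, h0, integral_const_mul, ← hT] at i3
    linear_combination -i3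
  have hTa : T a = 0 := by
    have d1 : HasDerivAt (fun μ => (μ - a) * T μ) (1 * T a + (a - a) * deriv T a) a :=
      ((hasDerivAt_id a).sub_const a).mul (differentiable_trans _ _ a).hasDerivAt
    have d2 : HasDerivAt (fun μ => (μ - a) * T μ) (dphi h Real.pi a * 0) a := by
      rw [funext e1, ← hd]
      exact ((differentiable_phi_pi h a).hasDerivAt).const_mul _
    have := d1.unique d2
    simpa using this
  rw [hT] at hTa
  rw [phi_eq] at h0
  have hid := cosq_sq_add Real.pi a
  -- The energy φ'² + aφ² is constant in x and equals h² + a.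
  have key : ∫ x, 2 * a * (phi h x a * phi h x a) ∂volPi = Real.pi * (h ^ 2 + a) + h := by
    have := cphi a
    have hE : ∀ x : ℝ, dphi h x a ^ 2 + a * phi h x a ^ 2 = h ^ 2 + a := fun x => by
      rw [phi_eq, dphi]; linear_combination (h ^ 2 + a) * cosq_sq_add x a
    have := integral_eq_of_hasDerivAt
      (u := fun x : ℝ => (x : ℂ) * (h ^ 2 + a) - phi h x a * dphi h x a)
      (u' := fun x => 2 * a * (phi h x a * phi h x a)) (fun x => by
        convert! ((Complex.ofRealCLM.hasDerivAt (x := x)).mul_const (h ^ 2 + a)).sub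
          ((hasDerivAt_phi h a x).mul (hasDerivAt_dphi h a x)) using 1
        simp only [Complex.ofRealCLM_apply, Complex.ofReal_one]
        linear_combination hE x) (by fun_prop)
    rw [this]
    simp only [phi_eq h Real.pi, h0]
    simp [phi_eq, dphi]
  rw [integral_const_mul, hTa, mul_zero] at key
  have hS : (h ^ 2 + a) * sinq Real.pi a ^ 2 = 1 := by
    rw [← hid]; linear_combination (-cosq Real.pi a + h * sinq Real.pi a) * h0
  have hh0 : h ^ 2 + a ≠ 0 := left_ne_zero_of_mul_eq_one hS
  have hS0 : sinq Real.pi a ≠ 0 := fun h1 => by simp [h1] at hS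
  -- For a = 0 no ρ ≠ 0 arises; there h = -1/π, and φ(x, 0) = 1 - x/π has square integral π/3 ≠ 0.
  by_cases ha : a = 0
  · subst ha
    have hne : h ≠ 0 := by rintro rfl; simp at hh0
    have h1 : (Real.pi : ℂ) * h = -1 := by
      have : h * (Real.pi * h + 1) = 0 := by linear_combination -key
      linear_combination (mul_eq_zero.1 this).resolve_left hne
    have h2 : (∫ x in Set.Ioo 0 Real.pi, (1 - x / Real.pi) ^ 2 : ℝ) = Real.pi / 3 := by
      rw [← integral_Ioc_eq_integral_Ioo, ← intervalIntegral.integral_of_le Real.pi_pos.le]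
      have hd : ∀ x : ℝ, HasDerivAt (fun x : ℝ => -(Real.pi / 3) * (1 - x / Real.pi) ^ 3)
          ((1 - x / Real.pi) ^ 2) x := fun x => by
        have := ((((hasDerivAt_id x).div_const Real.pi).const_sub 1).pow 3).const_mul
          (-(Real.pi / 3))
        convert! this using 1
        simp; field_simp
      rw [intervalIntegral.integral_eq_sub_of_hasDerivAt (fun x _ => hd x)
        ((by fun_prop : Continuous fun x : ℝ => (1 - x / Real.pi) ^ 2).intervalIntegrable _ _)]
      rw [div_self Real.pi_ne_zero]; simp
    have h3 : ∫ x, phi h x 0 * phi h x 0 ∂volPi =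
        ((∫ x in Set.Ioo 0 Real.pi, (1 - x / Real.pi) ^ 2 : ℝ) : ℂ) := by
      rw [← integral_complex_ofReal]
      congr 1; ext x
      have hp : (Real.pi : ℂ) ≠ 0 := by exact_mod_cast Real.pi_ne_zero
      have h4 : h = -1 / Real.pi := by field_simp; linear_combination h1
      simp only [phi, if_true, h4]
      push_cast
      ring
    rw [h3, h2] at hTa
    have := Real.pi_pos
    have h5 : Real.pi / 3 = 0 := by exact_mod_cast hTa
    linarith
  · have hr := csqrt_ne_zero ha
    have hr2 := csqrt_sq a
    set r := Complex.sqrt a with hrdef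
    have hp : (Real.pi : ℂ) ≠ 0 := by exact_mod_cast Real.pi_ne_zero
    have hC : Complex.cos (r * Real.pi) = cosq Real.pi a := rfl
    have hSn : Complex.sin (r * Real.pi) = r * sinq Real.pi a := by
      unfold sinq; rw [if_neg ha, ← hrdef]; field_simp
    refine hh ⟨2 * (r * Real.pi), by simp [hr, hp], ?_, ?_⟩
    · rw [Complex.sin_two_mul, hC, hSn]
      have : h * sinq Real.pi a ^ 2 = -Real.pi := by
        linear_combination Real.pi * (-hS) - key * sinq Real.pi a ^ 2
      linear_combination 2 * r * sinq Real.pi a * h0 - 2 * r * this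
    · rw [mul_div_cancel_left₀ _ (two_ne_zero), Complex.cot, hC, hSn]
      field_simp
      linear_combination h0

variable {m : ℕ}

/-- Unifies the two cases of the definition: u is the reciprocal of ∏ φ_i(π, ·), or, at a zero of
φ_s(π, ·), of the product without s times the derivative at μ₀. -/
theorem exists_chain_factor (h : Fin m → ℂ) (hh : Function.Injective h)
    (hZ : ∀ j, h j ∉ exceptionalSet) (μ₀ : ℂ) :
    ∃ u : ℂ → ℂ, AnalyticAt ℂ u μ₀ ∧ u μ₀ ≠ 0 ∧ ∀ ν j x, chain h μ₀ ν j x =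
      iteratedDeriv ν (fun μ => (u μ * ∏ i ∈ Finset.univ.erase j, phi (h i) Real.pi μ) *
        phi (h j) x μ) μ₀ := by
  have han : ∀ j, AnalyticAt ℂ (phi (h j) Real.pi) μ₀ := fun j =>
    (differentiable_phi_pi (h j)).analyticAt μ₀
  have hev : ∀ j, phi (h j) Real.pi μ₀ ≠ 0 → ∀ᶠ μ in nhds μ₀, phi (h j) Real.pi μ ≠ 0 := fun j hj =>
    (han j).continuousAt.eventually_ne hj
  by_cases hs : ∃ s, phi (h s) Real.pi μ₀ = 0
  · set s := hs.choose with hsdef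
    have hs0 : phi (h s) Real.pi μ₀ = 0 := hs.choose_spec
    have hne : ∀ j, j ≠ s → phi (h j) Real.pi μ₀ ≠ 0 := fun j hj h0 =>
      hj (hh (eq_of_phi_eq_zero h0 hs0))
    have hd := deriv_phi_pi_ne_zero (hZ s) hs0
    have hpr : (∏ i ∈ Finset.univ.erase s, phi (h i) Real.pi μ₀) ≠ 0 :=
      Finset.prod_ne_zero_iff.2 fun i hi => hne i (Finset.ne_of_mem_erase hi)
    refine ⟨fun μ => (deriv (phi (h s) Real.pi) μ₀ *
      ∏ i ∈ Finset.univ.erase s, phi (h i) Real.pi μ)⁻¹, ?_, ?_, fun ν j x => ?_⟩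
    · refine AnalyticAt.inv ?_ (mul_ne_zero hd hpr)
      exact analyticAt_const.mul (Finset.analyticAt_fun_prod _ fun i _ => han i)
    · exact inv_ne_zero (mul_ne_zero hd hpr)
    · have hall : ∀ᶠ μ in nhds μ₀, ∀ i, i ≠ s → phi (h i) Real.pi μ ≠ 0 :=
        Filter.eventually_all.2 fun i => by
          by_cases hi : i = s
          · simp [hi]
          · exact (hev i (hne i hi)).mono fun μ hμ _ => hμ
      unfold chain
      rw [dif_pos hs, ← hsdef]
      split_ifs with hj
      · subst hj
        refine Filter.EventuallyEq.iteratedDeriv_eq _ ?_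
        filter_upwards [hall] with μ hμ
        have : (∏ i ∈ Finset.univ.erase s, phi (h i) Real.pi μ) ≠ 0 :=
          Finset.prod_ne_zero_iff.2 fun i hi => hμ i (Finset.ne_of_mem_erase hi)
        field_simp
      · refine Filter.EventuallyEq.iteratedDeriv_eq _ ?_
        filter_upwards [hall] with μ hμ
        have hjs : j ∈ Finset.univ.erase s := Finset.mem_erase.2 ⟨hj, Finset.mem_univ _⟩
        have hsj : s ∈ Finset.univ.erase j := Finset.mem_erase.2 ⟨Ne.symm hj, Finset.mem_univ _⟩
        rw [← Finset.mul_prod_erase _ _ hjs, ← Finset.mul_prod_erase _ _ hsj,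
          Finset.erase_right_comm]
        have : (∏ i ∈ (Finset.univ.erase j).erase s, phi (h i) Real.pi μ) ≠ 0 :=
          Finset.prod_ne_zero_iff.2 fun i hi =>
            hμ i (Finset.ne_of_mem_erase hi)
        have := hμ j hj
        field_simp
  · have hne : ∀ j, phi (h j) Real.pi μ₀ ≠ 0 := fun j hj => hs ⟨j, hj⟩
    have hpr : (∏ i, phi (h i) Real.pi μ₀) ≠ 0 := Finset.prod_ne_zero_iff.2 fun i _ => hne i
    refine ⟨fun μ => (∏ i, phi (h i) Real.pi μ)⁻¹, ?_, inv_ne_zero hpr, fun ν j x => ?_⟩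
    · exact AnalyticAt.inv (Finset.analyticAt_fun_prod _ fun i _ => han i) hpr
    · have hall : ∀ᶠ μ in nhds μ₀, ∀ i, phi (h i) Real.pi μ ≠ 0 :=
        Filter.eventually_all.2 fun i => hev i (hne i)
      unfold chain
      rw [dif_neg hs]
      refine Filter.EventuallyEq.iteratedDeriv_eq _ ?_
      filter_upwards [hall] with μ hμ
      rw [← Finset.mul_prod_erase _ _ (Finset.mem_univ j)]
      have : (∏ i ∈ Finset.univ.erase j, phi (h i) Real.pi μ) ≠ 0 :=
        Finset.prod_ne_zero_iff.2 fun i _ => hμ i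
      have := hμ j
      field_simp

/-- The bilinear pairing on the product space. -/
def hPair (f : HSpace m) (v : Fin m → CPi) : ℂ := ∑ j, pairing (f j) (toL2 (v j))

/-- The pairing of f with the ν-th chain element is the ν-th derivative of u F_f at μ₀, and u(μ₀) ≠
0 does not affect the order. -/
theorem exists_chainC (h : Fin m → ℂ) (hh : Function.Injective h)
    (hZ : ∀ j, h j ∉ exceptionalSet) (μ₀ : ℂ) :
    ∃ w : ℕ → Fin m → CPi, (∀ ν j (x : Set.Icc 0 Real.pi), chain h μ₀ ν j x = w ν j x) ∧
      ∀ (f : HSpace m) (N : ℕ), (∀ ν < N, hPair f (w ν) = 0) ↔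
        (N : ℕ∞) ≤ analyticOrderAt (charF h f) μ₀ := by
  obtain ⟨u, hu, hu0, hc⟩ := exists_chain_factor h hh hZ μ₀
  let U : Fin m → ℂ → CPi := fun j μ =>
    (u μ * ∏ i ∈ Finset.univ.erase j, phi (h i) Real.pi μ) • phiC (h j) μ
  have hU : ∀ j, AnalyticAt ℂ (U j) μ₀ := fun j =>
    (hu.mul (Finset.analyticAt_fun_prod _ fun i _ =>
      (differentiable_phi_pi (h i)).analyticAt μ₀)).smul ((differentiable_phiC (h j)).analyticAt μ₀)
  refine ⟨fun ν j => iteratedDeriv ν (U j) μ₀, fun ν j x => ?_, fun f N => ?_⟩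
  · rw [hc]
    exact clm_iteratedDeriv (ContinuousMap.evalCLM (R := ℂ) x) (hU j) ν
  · have hF : AnalyticAt ℂ (charF h f) μ₀ := (differentiable_charF h f).analyticAt μ₀
    have h1 : ∀ ν, hPair f (fun j => iteratedDeriv ν (U j) μ₀) =
        iteratedDeriv ν (fun μ => u μ * charF h f μ) μ₀ := fun ν => by
      let L : (Fin m → CPi) →L[ℂ] ℂ := ∑ j, ((pairing (f j)).comp toL2).comp
        (ContinuousLinearMap.proj (R := ℂ) (φ := fun _ : Fin m => CPi) j)
      have hUU : AnalyticAt ℂ (fun μ j => U j μ) μ₀ := AnalyticAt.pi hU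
      have e1 := clm_iteratedDeriv L hUU ν
      have e2 : ∀ j, iteratedDeriv ν (U j) μ₀ = iteratedDeriv ν (fun μ j => U j μ) μ₀ j := fun j =>
        clm_iteratedDeriv (ContinuousLinearMap.proj (R := ℂ) (φ := fun _ : Fin m => CPi) j) hUU ν
      have e3 : ∀ v, L v = hPair f v := fun v => by simp [L, hPair]
      simp only [e3] at e1
      rw [funext e2, ← e1]
      congr 1
      ext μ
      simp only [hPair, U, map_smul, smul_eq_mul, charF, Finset.mul_sum, trans]
      exact Finset.sum_congr rfl fun j _ => by ring
    simp only [h1]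
    rw [← natCast_le_analyticOrderAt_iff_iteratedDeriv_eq_zero (hu.fun_mul hF)]
    have : analyticOrderAt (fun μ => u μ * charF h f μ) μ₀ = analyticOrderAt (charF h f) μ₀ := by
      have := analyticOrderAt_mul hu hF
      rw [hu.analyticOrderAt_eq_zero.2 hu0, zero_add] at this
      exact this
    rw [this]

end

/-! ### Asymptotics of φ near the frequencies n and n + 1/2. -/

section

open MeasureTheory Filter Asymptotics Topology

theorem norm_cos_sub_one_le {w : ℂ} (hw : ‖w‖ ≤ 1) : ‖Complex.cos w - 1‖ ≤ 2 * ‖w‖ := by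
  have h1 := Complex.norm_exp_sub_one_le (x := w * Complex.I) (by simpa using hw)
  have h2 := Complex.norm_exp_sub_one_le (x := -w * Complex.I) (by simpa using hw)
  have e : Complex.cos w - 1 =
      ((Complex.exp (w * Complex.I) - 1) + (Complex.exp (-w * Complex.I) - 1)) / 2 := by
    rw [Complex.cos]; ring
  rw [e, norm_div, Complex.norm_ofNat]
  have := norm_add_le (Complex.exp (w * Complex.I) - 1) (Complex.exp (-w * Complex.I) - 1)
  simp only [norm_mul, norm_neg, Complex.norm_I, mul_one] at h1 h2
  linarith

theorem norm_sin_sub_le {w : ℂ} (hw : ‖w‖ ≤ 1) : ‖Complex.sin w - w‖ ≤ ‖w‖ ^ 2 := by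
  have h1 := Complex.norm_exp_sub_one_sub_id_le (x := w * Complex.I) (by simpa using hw)
  have h2 := Complex.norm_exp_sub_one_sub_id_le (x := -w * Complex.I) (by simpa using hw)
  have e : Complex.sin w - w = ((Complex.exp (-w * Complex.I) - 1 - -w * Complex.I) -
      (Complex.exp (w * Complex.I) - 1 - w * Complex.I)) * Complex.I / 2 := by
    rw [Complex.sin]
    linear_combination -w * Complex.I_sq
  rw [e, norm_div, Complex.norm_ofNat, norm_mul, Complex.norm_I, mul_one]
  have := norm_sub_le (Complex.exp (-w * Complex.I) - 1 - -w * Complex.I)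
    (Complex.exp (w * Complex.I) - 1 - w * Complex.I)
  simp only [norm_mul, norm_neg, Complex.norm_I, mul_one] at h1 h2
  linarith

theorem norm_sin_le_two {w : ℂ} (hw : ‖w‖ ≤ 1) : ‖Complex.sin w‖ ≤ 2 * ‖w‖ := by
  have h1 := norm_sin_sub_le hw
  have h2 := norm_add_le (Complex.sin w - w) w
  rw [sub_add_cancel] at h2
  nlinarith [norm_nonneg w]

theorem norm_ofReal_cos_le (t : ℝ) : ‖Complex.cos t‖ ≤ 1 := by
  rw [← Complex.ofReal_cos, Complex.norm_real]; exact Real.abs_cos_le_one t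

theorem norm_ofReal_sin_le (t : ℝ) : ‖Complex.sin t‖ ≤ 1 := by
  rw [← Complex.ofReal_sin, Complex.norm_real]; exact Real.abs_sin_le_one t

/-- Expand cos ρx around (n + a)x with w = (ρ - n - a)x, |w| ≤ 1: both cos w - 1 and sin w are at
most 2|w|, which gives 4π, and |sin ρx| ≤ 3 + 2 gives 5. -/
theorem norm_phiC_sub_cosC_le (h : ℂ) (a : ℝ) (n : ℕ) {ρ : ℂ} (hρ : ρ ≠ 0)
    (hδ : ‖ρ - (n + a)‖ * Real.pi ≤ 1) :
    ‖phiC h (ρ ^ 2) - cosC a n‖ ≤ 4 * Real.pi * ‖ρ - (n + a)‖ + 5 * ‖h‖ * ‖ρ‖⁻¹ := by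
  have hpi := Real.pi_pos
  refine (ContinuousMap.norm_le _ (by positivity)).2 fun x => ?_
  set δ := ρ - (n + a) with hδdef
  have hw' : ‖δ * ((x : ℝ) : ℂ)‖ ≤ ‖δ‖ * Real.pi := by
    rw [norm_mul, Complex.norm_real, Real.norm_eq_abs, abs_of_nonneg x.2.1]
    gcongr
    exact x.2.2
  have hw := hw'.trans hδ
  have e1 : ρ * ((x : ℝ) : ℂ) = (((n + a) * x : ℝ) : ℂ) + δ * ((x : ℝ) : ℂ) := by
    rw [hδdef]; push_cast; ring
  have c1 := norm_cos_sub_one_le hw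
  have s1 := norm_sin_le_two hw
  have c2 := norm_ofReal_cos_le ((n + a) * x)
  have s2 := norm_ofReal_sin_le ((n + a) * x)
  have e2 : (phiC h (ρ ^ 2) - cosC a n) x =
      (Complex.cos (((n + a) * x : ℝ) : ℂ) * (Complex.cos (δ * ((x : ℝ) : ℂ)) - 1) -
        Complex.sin (((n + a) * x : ℝ) : ℂ) * Complex.sin (δ * ((x : ℝ) : ℂ))) +
      h * (Complex.sin (ρ * ((x : ℝ) : ℂ)) * ρ⁻¹) := by
    simp only [phiC, cosC, ContinuousMap.sub_apply, ContinuousMap.coe_mk, phi_eq, cosq_sq,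
      sinq_sq _ hρ, Complex.ofReal_cos]
    rw [e1, Complex.cos_add]; ring
  have b1 : ‖Complex.cos (((n + a) * x : ℝ) : ℂ) * (Complex.cos (δ * ((x : ℝ) : ℂ)) - 1) -
        Complex.sin (((n + a) * x : ℝ) : ℂ) * Complex.sin (δ * ((x : ℝ) : ℂ))‖ ≤
        4 * Real.pi * ‖δ‖ := by
    refine (norm_sub_le _ _).trans ?_
    rw [norm_mul, norm_mul]
    have := mul_le_mul c2 c1 (norm_nonneg _) zero_le_one
    have := mul_le_mul s2 s1 (norm_nonneg _) zero_le_one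
    linarith
  have b2 : ‖Complex.sin (ρ * ((x : ℝ) : ℂ))‖ ≤ 5 := by
    rw [e1, Complex.sin_add]
    refine (norm_add_le _ _).trans ?_
    rw [norm_mul, norm_mul]
    have c3 : ‖Complex.cos (δ * ((x : ℝ) : ℂ))‖ ≤ 3 := by
      have := norm_add_le (Complex.cos (δ * ((x : ℝ) : ℂ)) - 1) 1
      rw [sub_add_cancel, norm_one] at this
      linarith
    have := mul_le_mul s2 c3 (norm_nonneg _) zero_le_one
    have := mul_le_mul c2 s1 (norm_nonneg _) zero_le_one
    linarith
  rw [e2]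
  refine (norm_add_le _ _).trans (add_le_add b1 ?_)
  rw [norm_mul, norm_mul, norm_inv]
  have := norm_nonneg h
  have : 0 ≤ ‖ρ‖⁻¹ := by positivity
  calc ‖h‖ * (‖Complex.sin (ρ * ((x : ℝ) : ℂ))‖ * ‖ρ‖⁻¹) ≤ ‖h‖ * (5 * ‖ρ‖⁻¹) := by gcongr
    _ = _ := by ring

theorem phi_pi_half (h : ℂ) (n : ℕ) {ρ : ℂ} (hρ : ρ ≠ 0) :
    phi h Real.pi (ρ ^ 2) = (-1) ^ n * (-Complex.sin ((ρ - (n + 1 / 2)) * Real.pi) +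
      h * ρ⁻¹ * Complex.cos ((ρ - (n + 1 / 2)) * Real.pi)) := by
  have e1 : ρ * Real.pi = (ρ - (n + 1 / 2)) * Real.pi + Real.pi / 2 + n * Real.pi := by ring
  rw [phi_eq, cosq_sq, sinq_sq _ hρ, e1, Complex.cos_add _ (n * Real.pi : ℂ),
    Complex.sin_add _ (n * Real.pi : ℂ), cos_natCast_mul_pi, Complex.sin_nat_mul_pi,
    Complex.cos_add_pi_div_two, Complex.sin_add_pi_div_two]
  ring

theorem norm_cosC_le (a : ℝ) (n : ℕ) : ‖cosC a n‖ ≤ 1 :=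
  (ContinuousMap.norm_le _ zero_le_one).2 fun x => by
    simp only [cosC, ContinuousMap.coe_mk, Complex.norm_real]
    exact Real.abs_cos_le_one _

section Sequences
variable {ρ : ℕ → ℂ} {a : ℝ}

theorem inv_isBigO_of_sub (hδ : (fun n => ρ n - (n + a)) =O[atTop] fun n : ℕ => (n : ℝ)⁻¹) :
    (fun n => (ρ n)⁻¹) =O[atTop] (fun n : ℕ => (n : ℝ)⁻¹) ∧ ∀ᶠ n in atTop, ρ n ≠ 0 := by
  have hz : Tendsto (fun n => ρ n - (n + a)) atTop (𝓝 0) :=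
    hδ.trans_tendsto tendsto_inv_atTop_nhds_zero_nat
  have h1 : ∀ᶠ n : ℕ in atTop, (n : ℝ) / 2 ≤ ‖ρ n‖ := by
    have h2 := (tendsto_zero_iff_norm_tendsto_zero.1 hz).eventually_le_const (u := 1) one_pos
    have h3 : ∀ᶠ n : ℕ in atTop, 2 * (1 + ‖(a : ℂ)‖) ≤ (n : ℝ) :=
      tendsto_natCast_atTop_atTop.eventually_ge_atTop _
    filter_upwards [h2, h3] with n h2 h3
    have e : ((n : ℕ) : ℂ) = ρ n - (ρ n - (n + a)) - a := by ring
    have h4 : ‖((n : ℕ) : ℂ)‖ ≤ ‖ρ n‖ + ‖ρ n - (n + a)‖ + ‖(a : ℂ)‖ := by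
      conv_lhs => rw [e]
      exact (norm_sub_le _ _).trans (add_le_add (norm_sub_le _ _) le_rfl)
    rw [Complex.norm_natCast] at h4
    linarith
  refine ⟨IsBigO.of_bound 2 ?_, ?_⟩
  · filter_upwards [h1, eventually_ge_atTop 1] with n hn h1
    have hn1 : (1 : ℝ) ≤ n := by exact_mod_cast h1
    rw [norm_inv, norm_inv, Real.norm_natCast]
    have := inv_anti₀ (by positivity) hn
    rw [inv_div] at this
    rw [← div_eq_mul_inv]
    exact this
  · filter_upwards [h1, eventually_ge_atTop 1] with n hn h1 h0
    have hn1 : (1 : ℝ) ≤ n := by exact_mod_cast h1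
    rw [h0, norm_zero] at hn
    linarith

theorem eventually_small (hδ : (fun n => ρ n - (n + a)) =O[atTop] fun n : ℕ => (n : ℝ)⁻¹) :
    ∀ᶠ n in atTop, ‖ρ n - (n + a)‖ * Real.pi ≤ 1 := by
  have hz : Tendsto (fun n => ρ n - (n + a)) atTop (𝓝 0) :=
    hδ.trans_tendsto tendsto_inv_atTop_nhds_zero_nat
  have := (tendsto_zero_iff_norm_tendsto_zero.1 hz).mul_const Real.pi
  rw [zero_mul] at this
  exact this.eventually_le_const one_pos

theorem phiC_sub_cosC_isBigO (h : ℂ)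
    (hδ : (fun n => ρ n - (n + a)) =O[atTop] fun n : ℕ => (n : ℝ)⁻¹) :
    (fun n => phiC h (ρ n ^ 2) - cosC a n) =O[atTop] fun n : ℕ => (n : ℝ)⁻¹ := by
  obtain ⟨hi, hne⟩ := inv_isBigO_of_sub hδ
  have h1 : (fun n => 4 * Real.pi * ‖ρ n - (n + a)‖ + 5 * ‖h‖ * ‖ρ n‖⁻¹) =O[atTop]
      fun n : ℕ => (n : ℝ)⁻¹ := by
    refine (hδ.norm_left.const_mul_left _).add ?_
    simpa using (hi.norm_left.const_mul_left (5 * ‖h‖))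
  refine IsBigO.trans ?_ h1
  refine IsBigO.of_bound 1 ?_
  filter_upwards [hne, eventually_small hδ] with n h2 h3
  rw [one_mul]
  exact (norm_phiC_sub_cosC_le h a n h2 h3).trans (le_abs_self _)

theorem quotient_isBigO {Φ : ℕ → CPi} {d : ℕ → ℂ} {d₀ : ℂ} (hd₀ : d₀ ≠ 0)
    (hΦ : (fun n => Φ n - cosC a n) =O[atTop] fun n : ℕ => (n : ℝ)⁻¹)
    (hd : (fun n => d n - d₀) =O[atTop] fun n : ℕ => (n : ℝ)⁻¹) :
    (fun n => (d n)⁻¹ • Φ n - d₀⁻¹ • cosC a n) =O[atTop] (fun n : ℕ => (n : ℝ)⁻¹) ∧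
      ∀ᶠ n in atTop, d n ≠ 0 := by
  have hz : Tendsto d atTop (𝓝 d₀) := by
    have := (hd.trans_tendsto tendsto_inv_atTop_nhds_zero_nat).add_const d₀
    simpa using this
  have hne : ∀ᶠ n in atTop, d n ≠ 0 := hz.eventually_ne hd₀
  have hi : (fun n => (d n)⁻¹) =O[atTop] fun _ => (1 : ℝ) := (hz.inv₀ hd₀).isBigO_one ℝ
  have hc : (fun n => cosC a n) =O[atTop] fun _ : ℕ => (1 : ℝ) :=
    IsBigO.of_bound 1 (.of_forall fun n => by simpa using norm_cosC_le a n)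
  refine ⟨?_, hne⟩
  have h1 : (fun n => (d n)⁻¹ • (Φ n - cosC a n)) =O[atTop] fun n : ℕ => (n : ℝ)⁻¹ := by
    simpa using hi.smul hΦ
  have h2 : (fun n => (-d₀⁻¹ * ((d n)⁻¹ * (d n - d₀))) • cosC a n) =O[atTop]
      fun n : ℕ => (n : ℝ)⁻¹ := by
    refine (((hi.mul hd).const_mul_left (-d₀⁻¹)).smul hc).congr_right fun n => by simp
  refine (h1.add h2).congr' ?_ (.of_forall fun _ => rfl)
  filter_upwards [hne] with n hn
  have : (-d₀⁻¹ * ((d n)⁻¹ * (d n - d₀))) = (d n)⁻¹ - d₀⁻¹ := by field_simp; ring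
  rw [this]; module

theorem denom_int_isBigO (h : ℂ)
    (hδ : (fun n => ρ n - (n + (0 : ℝ))) =O[atTop] fun n : ℕ => (n : ℝ)⁻¹) :
    (fun n => (-1) ^ n * phi h Real.pi (ρ n ^ 2) - 1) =O[atTop] fun n : ℕ => (n : ℝ)⁻¹ := by
  refine IsBigO.trans ?_ (phiC_sub_cosC_isBigO h hδ)
  refine IsBigO.of_bound 1 (.of_forall fun n => ?_)
  let p : Set.Icc (0 : ℝ) Real.pi := ⟨Real.pi, Real.pi_pos.le, le_rfl⟩
  have h1 := (phiC h (ρ n ^ 2) - cosC 0 n).norm_coe_le_norm p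
  have h2 : (phiC h (ρ n ^ 2) - cosC 0 n) p = phi h Real.pi (ρ n ^ 2) - (-1) ^ n := by
    simp only [phiC, cosC, ContinuousMap.sub_apply, ContinuousMap.coe_mk, p, add_zero,
      Real.cos_nat_mul_pi]
    push_cast; rfl
  have h3 : (-1) ^ n * phi h Real.pi (ρ n ^ 2) - 1 =
      (-1) ^ n * (phi h Real.pi (ρ n ^ 2) - (-1) ^ n) := by
    rw [mul_sub, ← mul_pow]; norm_num
  rw [h3, norm_mul, norm_pow, norm_neg, norm_one, one_pow, one_mul, one_mul, ← h2]
  exact h1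

/-- By `phi_pi_half` the normalised value is -(n + 1/2) sin w + h (n + 1/2) ρ⁻¹ cos w with w = (ρ -
n - 1/2)π. Since (n + 1/2) w → z, the limit is h - z: the second term of the asymptotics is what
survives. -/
theorem denom_half_isBigO (h z : ℂ)
    (hδ : (fun n => ρ n - (n + (1 / 2 : ℝ))) =O[atTop] fun n : ℕ => (n : ℝ)⁻¹)
    (hz : (fun n : ℕ => ((n : ℂ) + 1 / 2) * ((ρ n - (n + (1 / 2 : ℝ))) * Real.pi) - z) =O[atTop]
      fun n : ℕ => (n : ℝ)⁻¹) :
    (fun n : ℕ => (-1) ^ n * ((n : ℂ) + 1 / 2) * phi h Real.pi (ρ n ^ 2) - (h - z)) =O[atTop]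
      fun n : ℕ => (n : ℝ)⁻¹ := by
  obtain ⟨hi, hne⟩ := inv_isBigO_of_sub hδ
  have hsm := eventually_small hδ
  let w : ℕ → ℂ := fun n => (ρ n - (n + (1 / 2 : ℝ))) * Real.pi
  have hw : w =O[atTop] fun n : ℕ => (n : ℝ)⁻¹ := by
    have := hδ.const_mul_left (Real.pi : ℂ)
    exact this.congr_left fun n => mul_comm _ _
  have hws : ∀ᶠ n in atTop, ‖w n‖ ≤ 1 := by
    filter_upwards [hsm] with n hn
    simp only [w]
    rw [norm_mul, Complex.norm_real, Real.norm_eq_abs, abs_of_pos Real.pi_pos]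
    exact hn
  have t1 : (fun n : ℕ => ((n : ℂ) + 1 / 2) * (Complex.sin (w n) - w n)) =O[atTop]
      fun n : ℕ => (n : ℝ)⁻¹ := by
    have a1 : (fun n => Complex.sin (w n) - w n) =O[atTop] fun n : ℕ => (n : ℝ)⁻¹ ^ 2 := by
      refine IsBigO.trans ?_ (hw.pow 2)
      refine IsBigO.of_bound 1 ?_
      filter_upwards [hws] with n hn
      rw [norm_pow, one_mul]; exact norm_sin_sub_le hn
    have a2 : (fun n : ℕ => (n : ℂ) + 1 / 2) =O[atTop] fun n : ℕ => (n : ℝ) := by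
      refine IsBigO.of_bound 2 ?_
      filter_upwards [eventually_ge_atTop 1] with n hn
      have hn1 : (1 : ℝ) ≤ n := by exact_mod_cast hn
      refine (norm_add_le _ _).trans ?_
      simp only [Complex.norm_natCast, Real.norm_natCast]
      norm_num
      linarith
    refine (a2.mul a1).trans ?_
    refine IsBigO.of_bound 1 ?_
    filter_upwards [eventually_ge_atTop 1] with n hn
    have hn1 : (n : ℝ) ≠ 0 := by exact_mod_cast (by omega : n ≠ 0)
    rw [one_mul]
    refine le_of_eq (congrArg norm ?_)
    field_simp
  have hcos : (fun n => Complex.cos (w n) - 1) =O[atTop] fun n : ℕ => (n : ℝ)⁻¹ := by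
    refine IsBigO.trans ?_ hw
    refine IsBigO.of_bound 2 ?_
    filter_upwards [hws] with n hn using norm_cos_sub_one_le hn
  have hcos1 : (fun n => Complex.cos (w n)) =O[atTop] fun _ : ℕ => (1 : ℝ) := by
    refine IsBigO.of_bound 3 ?_
    filter_upwards [hws] with n hn
    have h1 := norm_cos_sub_one_le hn
    have h2 := norm_add_le (Complex.cos (w n) - 1) 1
    rw [sub_add_cancel, norm_one] at h2
    simp only [norm_one, mul_one]
    linarith
  have t2 : (fun n => (ρ n - (n + (1 / 2 : ℝ))) * (ρ n)⁻¹ * Complex.cos (w n)) =O[atTop]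
      fun n : ℕ => (n : ℝ)⁻¹ := by
    have i1 : (fun n => (ρ n)⁻¹) =O[atTop] fun _ : ℕ => (1 : ℝ) :=
      hi.trans (tendsto_inv_atTop_nhds_zero_nat.isBigO_one ℝ)
    simpa using (hδ.mul i1).mul hcos1
  have tot := (((t1.neg_left).sub hz).add ((hcos.sub t2).const_mul_left h))
  refine tot.congr' ?_ (.of_forall fun _ => rfl)
  filter_upwards [hne] with n hn
  rw [phi_pi_half h n hn]
  have e0 : ((-1 : ℂ) ^ n) * (-1) ^ n = 1 := by rw [← mul_pow]; norm_num
  have e1 : (ρ n - (n + 1 / 2)) * Real.pi = w n := by simp [w]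
  have e2 : ((n : ℂ) + 1 / 2) * (ρ n)⁻¹ = 1 - (ρ n - (n + (1 / 2 : ℝ))) * (ρ n)⁻¹ := by
    push_cast; field_simp; ring
  have e3 : (ρ n - (n + (1 / 2 : ℝ))) * Real.pi = w n := rfl
  rw [e1, e3]
  linear_combination (-h * Complex.cos (w n)) * e2 -
    ((n : ℂ) + 1 / 2) * (-Complex.sin (w n) + h * (ρ n)⁻¹ * Complex.cos (w n)) * e0
end Sequences

end

/-! ### Asymptotics of the values λ_{nk} and of the vectors v_{nk}. -/

section

open MeasureTheory Filter Asymptotics Topology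

variable {m : ℕ}

/-- The shift `0` or `1 / 2` of the frequencies in the `k`-th series. -/
def shift (k : Fin m) : ℝ := if k.val = 0 then 0 else 1 / 2

theorem shift_cases (k : Fin m) : shift k = 0 ∨ shift k = 1 / 2 := by
  unfold shift; split_ifs <;> simp

theorem natCast_add_half_ne_zero (n : ℕ) : (n : ℂ) + 1 / 2 ≠ 0 := by
  intro h
  have h1 : ((2 * n + 1 : ℕ) : ℂ) ≠ 0 := Nat.cast_ne_zero.2 (by omega)
  exact h1 (by push_cast; linear_combination 2 * h)

theorem inv_half_isBigO :
    (fun n : ℕ => ((n : ℂ) + 1 / 2)⁻¹) =O[atTop] fun n : ℕ => (n : ℝ)⁻¹ := by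
  refine (inv_isBigO_of_sub (ρ := fun n => (n : ℂ) + 1 / 2) (a := 1 / 2) ?_).1
  simp only [Complex.ofReal_div, Complex.ofReal_one, Complex.ofReal_ofNat, sub_self]
  exact isBigO_zero _ _

theorem exists_remainder {z : Fin m → ℂ} {lam : ℕ → Fin m → ℂ} (hlam : HasAsymptotics z lam) :
    ∃ ϰ : ℕ → Fin m → ℂ, (∀ k, Tendsto (fun n => ϰ n k) atTop (𝓝 0)) ∧
    ∀ n : ℕ, 1 ≤ n → ∀ k : Fin m,
      Complex.sqrt (lam n k) =
        if k.val = 0 then (n : ℂ) + z k / (Real.pi * n) + ϰ n k / n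
        else (n : ℂ) + 1 / 2 + z k / (Real.pi * ((n : ℂ) + 1 / 2)) + ϰ n k / (n : ℂ) ^ 2 := by
  obtain ⟨ϰ, hs, h⟩ := hlam
  refine ⟨ϰ, fun k => ?_, h⟩
  have h1 := (hs.comp_injective (i := fun n : ℕ => (n, k)) fun _ _ h => (Prod.ext_iff.1 h).1)
  have h2 := (Real.continuous_sqrt.tendsto 0).comp h1.tendsto_atTop_zero
  rw [tendsto_zero_iff_norm_tendsto_zero]
  simpa [Function.comp_def] using h2

theorem sqrt_lam_isBigO {z : Fin m → ℂ} {lam : ℕ → Fin m → ℂ} (hlam : HasAsymptotics z lam)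
    (k : Fin m) : (fun n => Complex.sqrt (lam n k) - (n + (shift k : ℂ))) =O[atTop]
      fun n : ℕ => (n : ℝ)⁻¹ := by
  obtain ⟨ϰ, hϰ, h⟩ := exists_remainder hlam
  have hinv : (fun n : ℕ => (n : ℂ)⁻¹) =O[atTop] fun n : ℕ => (n : ℝ)⁻¹ :=
    IsBigO.of_bound 1 (.of_forall fun n => by simp)
  have hb := (hϰ k).isBigO_one ℝ
  by_cases hk : k.val = 0
  · have h1 : (fun n : ℕ => (z k / Real.pi) * (n : ℂ)⁻¹ + ϰ n k * (n : ℂ)⁻¹) =O[atTop]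
        fun n : ℕ => (n : ℝ)⁻¹ := (hinv.const_mul_left _).add (by simpa using hb.mul hinv)
    refine h1.congr' ?_ (.of_forall fun _ => rfl)
    filter_upwards [eventually_ge_atTop 1] with n hn
    rw [h n hn k, if_pos hk, shift, if_pos hk, Complex.ofReal_zero]
    have : (n : ℂ) ≠ 0 := by exact_mod_cast (by omega : n ≠ 0)
    field_simp
    ring
  · have hinv2 : (fun n : ℕ => (n : ℂ)⁻¹ * (n : ℂ)⁻¹) =O[atTop] fun n : ℕ => (n : ℝ)⁻¹ := by
      simpa using hinv.mul (hinv.trans (tendsto_inv_atTop_nhds_zero_nat.isBigO_one ℝ))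
    have h1 : (fun n : ℕ => (z k / Real.pi) * ((n : ℂ) + 1 / 2)⁻¹ +
        ϰ n k * ((n : ℂ)⁻¹ * (n : ℂ)⁻¹)) =O[atTop] fun n : ℕ => (n : ℝ)⁻¹ :=
      (inv_half_isBigO.const_mul_left _).add (by simpa using hb.mul hinv2)
    refine h1.congr' ?_ (.of_forall fun _ => rfl)
    filter_upwards [eventually_ge_atTop 1] with n hn
    rw [h n hn k, if_neg hk, shift, if_neg hk]
    have := natCast_add_half_ne_zero n
    have : (n : ℂ) ≠ 0 := by exact_mod_cast (by omega : n ≠ 0)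
    have : (Real.pi : ℂ) ≠ 0 := by exact_mod_cast Real.pi_ne_zero
    push_cast
    generalize (n : ℂ) + 1 / 2 = p at *
    field_simp
    ring

theorem sqrt_lam_second_isBigO {z : Fin m → ℂ} {lam : ℕ → Fin m → ℂ}
    (hlam : HasAsymptotics z lam) (k : Fin m) (hk : k.val ≠ 0) :
    (fun n : ℕ => ((n : ℂ) + 1 / 2) * ((Complex.sqrt (lam n k) - (n + (1 / 2 : ℝ))) * Real.pi)
      - z k) =O[atTop] fun n : ℕ => (n : ℝ)⁻¹ := by
  obtain ⟨ϰ, hϰ, h⟩ := exists_remainder hlam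
  have hb := ((hϰ k).isBigO_one ℝ).const_mul_left (Real.pi : ℂ)
  have h1 : (fun n : ℕ => ((n : ℂ) + 1 / 2) / (n : ℂ) ^ 2) =O[atTop] fun n : ℕ => (n : ℝ)⁻¹ := by
    refine IsBigO.of_bound 2 ?_
    filter_upwards [eventually_ge_atTop 1] with n hn
    have hn1 : (1 : ℝ) ≤ n := by exact_mod_cast hn
    have h2 := norm_add_le (n : ℂ) (1 / 2)
    have h3 : ‖(1 / 2 : ℂ)‖ = 1 / 2 := by norm_num
    rw [h3, Complex.norm_natCast] at h2
    rw [norm_div, norm_pow, Complex.norm_natCast, norm_inv, Real.norm_natCast,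
      div_le_iff₀ (by positivity)]
    have h5 : 2 * (n : ℝ)⁻¹ * (n : ℝ) ^ 2 = 2 * n := by field_simp
    rw [h5]
    linarith
  have h4 := hb.mul h1
  simp only [one_mul] at h4
  refine h4.congr' ?_ (.of_forall fun _ => rfl)
  filter_upwards [eventually_ge_atTop 1] with n hn
  rw [h n hn k, if_neg hk]
  have := natCast_add_half_ne_zero n
  have : (n : ℂ) ≠ 0 := by exact_mod_cast (by omega : n ≠ 0)
  have : (Real.pi : ℂ) ≠ 0 := by exact_mod_cast Real.pi_ne_zero
  push_cast
  generalize (n : ℂ) + 1 / 2 = p at *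
  field_simp
  ring

theorem eventually_sqrt_close {z : Fin m → ℂ} {lam : ℕ → Fin m → ℂ} (hlam : HasAsymptotics z lam) :
    ∃ N : ℕ, ∀ n ≥ N, ∀ k, ‖Complex.sqrt (lam n k) - (n + (shift k : ℂ))‖ < 1 / 8 := by
  refine eventually_atTop.1 (eventually_all.2 fun k => ?_)
  have h1 := (sqrt_lam_isBigO hlam k).trans_tendsto tendsto_inv_atTop_nhds_zero_nat
  exact (tendsto_zero_iff_norm_tendsto_zero.1 h1).eventually_lt_const (by norm_num)

theorem shift_nonneg (k : Fin m) : 0 ≤ shift k := by unfold shift; split_ifs <;> norm_num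

theorem natCast_lt_norm_sqrt {lam : ℕ → Fin m → ℂ} {n : ℕ} {k : Fin m}
    (h : ‖Complex.sqrt (lam n k) - (n + (shift k : ℂ))‖ < 1 / 8) :
    (n : ℝ) < ‖Complex.sqrt (lam n k)‖ + 1 / 8 := by
  have e : ‖((n : ℂ) + (shift k : ℂ))‖ = n + shift k := by
    rw [← Complex.ofReal_natCast, ← Complex.ofReal_add, Complex.norm_real, Real.norm_eq_abs,
      abs_of_nonneg (add_nonneg n.cast_nonneg (shift_nonneg k))]
  have h1 := norm_sub_norm_le ((n : ℂ) + (shift k : ℂ)) (Complex.sqrt (lam n k))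
  rw [norm_sub_rev, e] at h1
  linarith [shift_nonneg k]

theorem finite_setOf_norm_lam_le {z : Fin m → ℂ} {lam : ℕ → Fin m → ℂ}
    (hlam : HasAsymptotics z lam) (R : ℝ) : {p : ℕ × Fin m | ‖lam p.1 p.2‖ ≤ R}.Finite := by
  obtain ⟨N, hN⟩ := eventually_sqrt_close hlam
  refine Set.Finite.subset ((Set.finite_Iio (N + ⌈R + 2⌉₊)).prod (Set.finite_univ (α := Fin m)))
    fun p hp => ⟨?_, trivial⟩
  rw [Set.mem_Iio]
  by_contra! hlt
  have h1 := natCast_lt_norm_sqrt (hN p.1 (by omega) p.2)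
  have h2 : R + 2 ≤ p.1 := (Nat.le_ceil _).trans (by exact_mod_cast (by omega : ⌈R + 2⌉₊ ≤ p.1))
  have h3 : ‖Complex.sqrt (lam p.1 p.2)‖ ^ 2 ≤ R := by rw [← norm_pow, csqrt_sq]; exact hp
  nlinarith [norm_nonneg (Complex.sqrt (lam p.1 p.2)), sq_nonneg (‖Complex.sqrt (lam p.1 p.2)‖ - 1)]

/-- For large n the value λ_{nk} has no earlier occurrence: roots near different points n + a lie
apart, and those near the same n + 1/2 are separated by the distinct z_k. -/
theorem eventually_chainPos_eq_zero {z : Fin m → ℂ} {lam : ℕ → Fin m → ℂ}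
    (hlam : HasAsymptotics z lam)
    (hz : ∀ k l : Fin m, k.val ≠ 0 → l.val ≠ 0 → z k = z l → k = l) (k : Fin m) :
    ∀ᶠ n in atTop, chainPos lam n k = 0 := by
  obtain ⟨N, hN⟩ := eventually_sqrt_close hlam
  obtain ⟨R, hR⟩ : ∃ R : ℝ, ∀ l < N, ∀ r, ‖Complex.sqrt (lam l r)‖ ≤ R := by
    obtain ⟨R, hR⟩ := ((Set.finite_Iio N).prod (Set.finite_univ (α := Fin m))).image
      (fun p => ‖Complex.sqrt (lam p.1 p.2)‖) |>.bddAbove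
    exact ⟨R, fun l hl r => hR ⟨(l, r), ⟨hl, trivial⟩, rfl⟩⟩
  have hsep : ∀ᶠ n in atTop, ∀ r : Fin m, r ≠ k → r.val ≠ 0 → k.val ≠ 0 → lam n r ≠ lam n k := by
    refine eventually_all.2 fun r => ?_
    by_cases hr : r ≠ k ∧ r.val ≠ 0 ∧ k.val ≠ 0
    · obtain ⟨h1, h2, h3⟩ := hr
      have a1 := (sqrt_lam_second_isBigO hlam r h2).trans_tendsto tendsto_inv_atTop_nhds_zero_nat
      have a2 := (sqrt_lam_second_isBigO hlam k h3).trans_tendsto tendsto_inv_atTop_nhds_zero_nat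
      have a3 := a1.sub a2
      rw [sub_zero] at a3
      have hne : z k - z r ≠ 0 := sub_ne_zero.2 fun h => h1 (hz r k h2 h3 h.symm)
      filter_upwards [a3.eventually_ne hne.symm] with n hn _ _ _ heq
      refine hn ?_
      rw [heq]; ring
    · exact .of_forall fun n h1 h2 h3 => absurd ⟨h1, h2, h3⟩ hr
  filter_upwards [hsep, eventually_ge_atTop N,
    tendsto_natCast_atTop_atTop.eventually_ge_atTop (R + 1)] with n h1 h2 h3
  have hempty : {p : ℕ × Fin m | toLex p < toLex (n, k) ∧ lam p.1 p.2 = lam n k} = ∅ := by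
    rw [Set.eq_empty_iff_forall_notMem]
    rintro ⟨l, r⟩ ⟨hlt, heq⟩
    simp only at heq
    have hk := hN n h2 k
    by_cases hl : l < N
    · have a1 := hR l hl r
      rw [heq] at a1
      have := natCast_lt_norm_sqrt hk
      linarith
    · have hr := hN l (by omega) r
      rw [heq] at hr
      have a1 := norm_sub_le (Complex.sqrt (lam n k) - (n + (shift k : ℂ)))
        (Complex.sqrt (lam n k) - (l + (shift r : ℂ)))
      have e : (Complex.sqrt (lam n k) - (n + (shift k : ℂ))) -
        (Complex.sqrt (lam n k) - (l + (shift r : ℂ))) =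
          (((l + shift r) - (n + shift k) : ℝ) : ℂ) := by push_cast; ring
      rw [e, Complex.norm_real, Real.norm_eq_abs] at a1
      -- The points n and n + 1/2 are at least 1/2 apart, so a distance below 1/4 forces equality.
      have a2 : |((l : ℝ) + shift r) - (n + shift k)| < 1 / 4 := by linarith
      rw [abs_lt] at a2
      have a4 : shift r = shift k ∧ l = n := by
        rcases shift_cases r with b1 | b1 <;> rcases shift_cases k with b2 | b2 <;>
          rw [b1, b2] at a2 ⊢
        · exact ⟨rfl, by
            have c1 : (l : ℝ) < n + 1 := by linarith
            have c2 : (n : ℝ) < l + 1 := by linarith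
            have : l < n + 1 := by exact_mod_cast c1
            have : n < l + 1 := by exact_mod_cast c2
            omega⟩
        · exfalso
          have c1 : (l : ℝ) < n + 1 := by linarith
          have c2 : (n : ℝ) < l := by linarith
          have : l < n + 1 := by exact_mod_cast c1
          have : n < l := by exact_mod_cast c2
          omega
        · exfalso
          have c1 : (l : ℝ) < n := by linarith
          have c2 : (n : ℝ) < l + 1 := by linarith
          have : l < n := by exact_mod_cast c1
          have : n < l + 1 := by exact_mod_cast c2
          omega
        · exact ⟨rfl, by
            have c1 : (l : ℝ) < n + 1 := by linarith
            have c2 : (n : ℝ) < l + 1 := by linarith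
            have : l < n + 1 := by exact_mod_cast c1
            have : n < l + 1 := by exact_mod_cast c2
            omega⟩
      obtain ⟨a5, rfl⟩ := a4
      have hrk : r ≠ k := by rintro rfl; exact lt_irrefl _ hlt
      unfold shift at a5
      by_cases hr0 : r.val = 0
      · by_cases hk0 : k.val = 0
        · exact hrk (Fin.ext (hr0.trans hk0.symm))
        · rw [if_pos hr0, if_neg hk0] at a5; norm_num at a5
      · by_cases hk0 : k.val = 0
        · rw [if_neg hr0, if_pos hk0] at a5; norm_num at a5
        · exact h1 r hrk hr0 hk0 heq
  rw [chainPos, hempty, Set.ncard_empty]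

/-- The coefficients of the limit vectors. -/
def limMat (h z : Fin m → ℂ) : Matrix (Fin m) (Fin m) ℂ :=
  Matrix.of fun j k => if k.val = 0 then 1 else (h j - z k)⁻¹

theorem vFun_sub_isBigO {h z : Fin m → ℂ} {lam : ℕ → Fin m → ℂ} (hlam : HasAsymptotics z lam)
    (hz : ∀ k l : Fin m, k.val ≠ 0 → l.val ≠ 0 → z k = z l → k = l)
    (hhz : ∀ j k : Fin m, k.val ≠ 0 → h j ≠ z k) (V : ℕ → Fin m → Fin m → CPi)
    (hV : ∀ n k j (x : Set.Icc 0 Real.pi), vFun h lam n k j x = V n k j x) (k j : Fin m) :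
    (fun n => V n k j - limMat h z j k • cosC (shift k) n) =O[atTop] fun n : ℕ => (n : ℝ)⁻¹ := by
  have hδ := sqrt_lam_isBigO hlam k
  have hpos := eventually_chainPos_eq_zero hlam hz k
  have hsq : ∀ n, lam n k = Complex.sqrt (lam n k) ^ 2 := fun n => (csqrt_sq _).symm
  -- The total denominator, v_{nk,j} = φ_j / d_j, since (-1)^n is its own inverse. Its nonzero limit
  -- also excludes case (ii) for large n.
  let d : Fin m → ℕ → ℂ := fun i n => if k.val = 0 then (-1) ^ n * phi (h i) Real.pi (lam n k)
    else (-1) ^ n * ((n : ℂ) + 1 / 2) * phi (h i) Real.pi (lam n k)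
  let d₀ : Fin m → ℂ := fun i => if k.val = 0 then 1 else h i - z k
  have hd : ∀ i, (fun n => d i n - d₀ i) =O[atTop] fun n : ℕ => (n : ℝ)⁻¹ := fun i => by
    simp only [d, d₀]
    by_cases hk : k.val = 0
    · have e : shift k = 0 := by simp [shift, hk]
      rw [e] at hδ
      have := denom_int_isBigO (h i) hδ
      simpa only [if_pos hk, csqrt_sq] using this
    · have e : shift k = 1 / 2 := by simp [shift, hk]
      rw [e] at hδ
      have := denom_half_isBigO (h i) (z k) hδ (sqrt_lam_second_isBigO hlam k hk)
      simpa only [if_neg hk, csqrt_sq] using this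
  have hd₀ : ∀ i, d₀ i ≠ 0 := fun i => by
    simp only [d₀]; split_ifs with hk
    · exact one_ne_zero
    · exact sub_ne_zero.2 (hhz i k hk)
  have hΦ : ∀ i, (fun n => phiC (h i) (lam n k) - cosC (shift k) n) =O[atTop]
      fun n : ℕ => (n : ℝ)⁻¹ := fun i => by
    have := phiC_sub_cosC_isBigO (h i) hδ
    simpa only [csqrt_sq] using this
  have hne : ∀ᶠ n in atTop, ∀ i, d i n ≠ 0 :=
    eventually_all.2 fun i => (quotient_isBigO (hd₀ i) (hΦ i) (hd i)).2
  refine (quotient_isBigO (hd₀ j) (hΦ j) (hd j)).1.congr' ?_ (.of_forall fun _ => rfl)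
  filter_upwards [hne, hpos] with n hn hp
  have hnz : ¬ ∃ s, phi (h s) Real.pi (lam n k) = 0 := by
    rintro ⟨s, hs⟩
    exact hn s (by simp only [d, hs, mul_zero, ite_self])
  have hneg : ((-1 : ℂ) ^ n)⁻¹ = (-1) ^ n := by rw [← inv_pow]; norm_num
  ext x
  have hx := hV n k j x
  simp only [vFun, yFun, hp, chain, dif_neg hnz, iteratedDeriv_zero] at hx
  simp only [ContinuousMap.sub_apply, ContinuousMap.smul_apply, ← hx, limMat, Matrix.of_apply, d,
    d₀, phiC, ContinuousMap.coe_mk, smul_eq_mul]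
  split_ifs with hk
  · rw [mul_inv, hneg, inv_one]; ring
  · rw [mul_inv, mul_inv, hneg]; ring

end

/-! ### Multiplicities, division by a finite part of the spectrum, completeness. -/

section

open MeasureTheory Filter Asymptotics Topology

variable {m : ℕ}

section Counting
variable {lam : ℕ → Fin m → ℂ}

/-- The indices that carry the value `μ`. -/
def valueSet (lam : ℕ → Fin m → ℂ) (μ : ℂ) : Set (ℕ × Fin m) := {p | lam p.1 p.2 = μ}

theorem chainPos_lt_ncard (hfin : ∀ μ, (valueSet lam μ).Finite) (p : ℕ × Fin m) :
    chainPos lam p.1 p.2 < (valueSet lam (lam p.1 p.2)).ncard := by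
  refine Set.ncard_lt_ncard ⟨fun q hq => hq.2, fun hsub => ?_⟩ (hfin _)
  have := hsub (show p ∈ valueSet lam (lam p.1 p.2) from rfl)
  exact lt_irrefl _ this.1

theorem chainPos_lt_chainPos (hfin : ∀ μ, (valueSet lam μ).Finite) {p q : ℕ × Fin m}
    (hpq : toLex p < toLex q) (h : lam p.1 p.2 = lam q.1 q.2) :
    chainPos lam p.1 p.2 < chainPos lam q.1 q.2 := by
  refine Set.ncard_lt_ncard ⟨fun r hr => ⟨lt_trans hr.1 hpq, hr.2.trans h⟩, fun hsub => ?_⟩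
    ((hfin (lam q.1 q.2)).subset fun r hr => hr.2)
  have := hsub (show p ∈ _ from ⟨hpq, h⟩)
  exact lt_irrefl _ this.1

/-- On the indices carrying a value the position is injective and below their number, so it exhausts
0, …, number - 1: each value uses a full initial piece of its chain. -/
theorem exists_chainPos_eq (hfin : ∀ μ, (valueSet lam μ).Finite) (μ : ℂ) {ν : ℕ}
    (hν : ν < (valueSet lam μ).ncard) : ∃ p : ℕ × Fin m, lam p.1 p.2 = μ ∧ chainPos lam p.1 p.2 = ν := by
  classical
  have hcard : (valueSet lam μ).ncard = (hfin μ).toFinset.card := Set.ncard_eq_toFinset_card _ _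
  have hsurj := Finset.surjOn_of_injOn_of_card_le (s := (hfin μ).toFinset)
    (t := Finset.range (valueSet lam μ).ncard) (fun p => chainPos lam p.1 p.2)
    (fun p hp => by
      have hp' : lam p.1 p.2 = μ := by simpa [valueSet] using hp
      have := chainPos_lt_ncard hfin p
      rw [hp'] at this
      simpa using this)
    (fun p hp q hq h => by
      have hp' : lam p.1 p.2 = μ := by simpa [valueSet] using hp
      have hq' : lam q.1 q.2 = μ := by simpa [valueSet] using hq
      rcases lt_trichotomy (toLex p) (toLex q) with h1 | h1 | h1
      · exact absurd h (chainPos_lt_chainPos hfin h1 (hp'.trans hq'.symm)).ne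
      · exact toLex.injective h1
      · exact absurd h (chainPos_lt_chainPos hfin h1 (hq'.trans hp'.symm)).ne')
    (by rw [Finset.card_range, hcard])
  obtain ⟨p, hp, h⟩ := hsurj (show ν ∈ (Finset.range _ : Set ℕ) by simpa using hν)
  exact ⟨p, by simpa [valueSet] using hp, h⟩

end Counting

/-- The bilinear pairing on the Hilbert space, as a functional of the second argument. -/
def hPairL (f : HSpace m) : HSpace m →L[ℂ] ℂ :=
  ∑ j, (pairing (f j)).comp (PiLp.proj 2 (fun _ : Fin m => Lp ℂ 2 volPi) j)

theorem hPairL_apply (f g : HSpace m) : hPairL f g = ∑ j, pairing (f j) (g j) := by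
  simp [hPairL]

theorem hPairL_toLp (f : HSpace m) (v : Fin m → CPi) :
    hPairL f (WithLp.toLp 2 fun j => toL2 (v j)) = hPair f v := hPairL_apply _ _

/-- The bilinear pairing as a functional of the first argument. -/
def hPairR (g : HSpace m) : HSpace m →ₗ[ℂ] ℂ where
  toFun f := hPairL f g
  map_add' f f' := by simp [hPairL_apply, pairing_add, Finset.sum_add_distrib]
  map_smul' c f := by simp [hPairL_apply, pairing_smul, Finset.mul_sum]

/-- Componentwise complex conjugation. -/
def conjH (f : HSpace m) : HSpace m := WithLp.toLp 2 fun j => star (f j)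

theorem conjH_conjH (f : HSpace m) : conjH (conjH f) = f := by
  ext1 j; exact star_star (f j)

theorem hPairL_conjH (f g : HSpace m) : hPairL (conjH f) g = inner ℂ f g := by
  rw [hPairL_apply, PiLp.inner_apply]
  refine Finset.sum_congr rfl fun j _ => ?_
  simp [pairing, conjH]

theorem eq_zero_of_hPairL_basis {ι : Type*} (b : HilbertBasis ι ℂ (HSpace m))
    (T : HSpace m ≃L[ℂ] HSpace m) (f : HSpace m) (H : ∀ p, hPairL f (T (b p)) = 0) : f = 0 := by
  have h1 : (hPairL f).comp (T : HSpace m →L[ℂ] HSpace m) = 0 := by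
    refine ContinuousLinearMap.ext_on (s := Set.range b)
      (Submodule.dense_iff_topologicalClosure_eq_top.2 b.dense_span) ?_
    rintro _ ⟨p, rfl⟩
    exact H p
  have h2 : hPairL f (conjH f) = 0 := by
    have := DFunLike.congr_fun h1 (T.symm (conjH f))
    simpa using this
  rw [← conjH_conjH f, hPairL_conjH, conjH_conjH] at h2
  have h3 := inner_self_eq_zero.1 h2
  rw [← conjH_conjH f, h3]
  ext1 j
  simp only [conjH, PiLp.zero_apply]
  rw [← norm_eq_zero, norm_star_Lp, norm_zero]

open Polynomial in
theorem sum_ne_zero_of_natDegree {D : ℕ} (q : Fin (D + 1) → ℂ[X]) (hq : ∀ i, (q i).Monic)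
    (hdeg : ∀ i, (q i).natDegree = i) (c : Fin (D + 1) → ℂ) (hc : c ≠ 0) :
    ∑ i, C (c i) * q i ≠ 0 := by
  classical
  obtain ⟨i₁, hi₁⟩ := Function.ne_iff.1 hc
  let s := Finset.univ.filter fun i => c i ≠ 0
  have hs : s.Nonempty := ⟨i₁, by simpa [s] using hi₁⟩
  have hmem := s.max'_mem hs
  set i₀ := s.max' hs
  have hi₀ : c i₀ ≠ 0 := by simpa [s] using hmem
  intro h0
  have h1 := congrArg (fun p => p.coeff i₀) h0
  simp only [finsetSum_coeff, coeff_C_mul, coeff_zero] at h1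
  rw [Finset.sum_eq_single i₀] at h1
  · have := (hq i₀).coeff_natDegree
    rw [hdeg] at this
    rw [this, mul_one] at h1
    exact hi₀ h1
  · intro i _ hi
    by_cases hci : c i = 0
    · rw [hci, zero_mul]
    · have hle : i ≤ i₀ := s.le_max' i (by simpa [s] using hci)
      have hlt : (i : ℕ) < i₀ := Fin.lt_def.1 (lt_of_le_of_ne hle hi)
      rw [coeff_eq_zero_of_natDegree_lt (by rw [hdeg]; exact hlt), mul_zero]
  · simp

/-- Division of the characteristic function by the factors of a finite part of the spectrum. -/
theorem exists_charF_prod_div (h : Fin m → ℂ) (hh : Function.Injective h) {lam : ℕ → Fin m → ℂ}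
    (hfin : ∀ μ, (valueSet lam μ).Finite) (f : HSpace m)
    (hf : ∀ μ, ((valueSet lam μ).ncard : ℕ∞) ≤ analyticOrderAt (charF h f) μ)
    (S : Finset (ℕ × Fin m)) :
    ∃ y : HSpace m, ∀ μ, charF h f μ = (∏ p ∈ S, (μ - lam p.1 p.2)) * charF h y μ := by
  classical
  induction S using Finset.induction_on with
  | empty => exact ⟨f, fun μ => by simp⟩
  | insert q S hq ih =>
    obtain ⟨y, hy⟩ := ih
    suffices hyq : charF h y (lam q.1 q.2) = 0 by
      obtain ⟨y', hy'⟩ := exists_charF_div h hh y _ hyq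
      refine ⟨y', fun μ => ?_⟩
      rw [hy, hy', Finset.prod_insert hq]; ring
    by_contra hne
    set μ₀ := lam q.1 q.2 with hμ₀
    -- If F_y(μ₀) ≠ 0, the order of F_f at μ₀ counts only the indices in S with value μ₀, which is
    -- too few because q ∉ S also has this value.
    have hord : analyticOrderAt (charF h f) μ₀ = ((S.filter fun p => lam p.1 p.2 = μ₀).card : ℕ∞) := by
      have e : charF h f = fun μ => (∏ p ∈ S.filter (fun p => lam p.1 p.2 = μ₀), (μ - μ₀)) *
          ((∏ p ∈ S.filter (fun p => ¬ lam p.1 p.2 = μ₀), (μ - lam p.1 p.2)) * charF h y μ) := by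
        ext μ
        rw [hy, ← Finset.prod_filter_mul_prod_filter_not S (fun p => lam p.1 p.2 = μ₀), mul_assoc]
        congr 1
        exact Finset.prod_congr rfl fun p hp => by rw [(Finset.mem_filter.1 hp).2]
      have hy0 : AnalyticAt ℂ (charF h y) μ₀ := (differentiable_charF h y).analyticAt μ₀
      have han : AnalyticAt ℂ (fun μ => (∏ p ∈ S.filter (fun p => ¬ lam p.1 p.2 = μ₀),
          (μ - lam p.1 p.2)) * charF h y μ) μ₀ :=
        (Finset.analyticAt_fun_prod _ fun p _ => by fun_prop).fun_mul hy0
      rw [(AnalyticAt.analyticOrderAt_eq_natCast (by rw [e]; simp only [Finset.prod_const]; fun_prop))]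
      refine ⟨_, han, ?_, .of_forall fun μ => ?_⟩
      · refine mul_ne_zero (Finset.prod_ne_zero_iff.2 fun p hp => ?_) hne
        exact sub_ne_zero.2 fun h0 => (Finset.mem_filter.1 hp).2 h0.symm
      · rw [e]; simp only [Finset.prod_const, smul_eq_mul]
    have h1 := hf μ₀
    rw [hord, Nat.cast_le] at h1
    have h2 : (S.filter fun p => lam p.1 p.2 = μ₀).card < (valueSet lam μ₀).ncard := by
      rw [← Set.ncard_coe_finset]
      refine Set.ncard_lt_ncard ⟨fun p hp => ?_, fun hsub => ?_⟩ (hfin _)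
      · simpa [valueSet] using (Finset.mem_filter.1 (Finset.mem_coe.1 hp)).2
      · have := hsub (show q ∈ valueSet lam μ₀ from rfl)
        exact hq (Finset.mem_filter.1 (Finset.mem_coe.1 this)).1
    omega

theorem analyticOrderAt_mul_of_ne_zero {u g : ℂ → ℂ} {μ : ℂ} (hu : AnalyticAt ℂ u μ)
    (hg : AnalyticAt ℂ g μ) (h0 : u μ ≠ 0) :
    analyticOrderAt (fun x => u x * g x) μ = analyticOrderAt g μ := by
  have := analyticOrderAt_mul hu hg
  rw [hu.analyticOrderAt_eq_zero.2 h0, zero_add] at this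
  exact this

/-- Completeness: only the zero functional annihilates the whole system. -/
theorem eq_zero_of_annihilates (h : Fin m → ℂ) (hh : Function.Injective h) {lam : ℕ → Fin m → ℂ}
    (hfin : ∀ R : ℝ, {p : ℕ × Fin m | ‖lam p.1 p.2‖ ≤ R}.Finite)
    (v : ℕ × Fin m → HSpace m)
    (hv₁ : ∀ f, (∀ p, hPairL f (v p) = 0) → ∀ μ,
      ((valueSet lam μ).ncard : ℕ∞) ≤ analyticOrderAt (charF h f) μ)
    (hv₂ : ∀ f p, ((valueSet lam (lam p.1 p.2)).ncard : ℕ∞) ≤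
      analyticOrderAt (charF h f) (lam p.1 p.2) → hPairL f (v p) = 0)
    (b : HilbertBasis (ℕ × Fin m) ℂ (HSpace m)) (T : HSpace m ≃L[ℂ] HSpace m) (R : ℝ)
    (hT : ∀ p, R < ‖lam p.1 p.2‖ → T (b p) = v p)
    (f : HSpace m) (hf : ∀ p, hPairL f (v p) = 0) : f = 0 := by
  classical
  have hfin' : ∀ μ, (valueSet lam μ).Finite := fun μ =>
    (hfin ‖μ‖).subset fun p (hp : lam p.1 p.2 = μ) => by simp [hp]
  -- A whole disc of values, so no repeated value is split between S and its complement.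
  let S := (hfin R).toFinset
  have hS : ∀ p, p ∉ S → R < ‖lam p.1 p.2‖ := fun p hp => by simpa [S] using hp
  have hS' : ∀ p, p ∈ S → ‖lam p.1 p.2‖ ≤ R := fun p hp => by simpa [S] using hp
  have hinj : ∀ w : HSpace m, (∀ p ∈ S, hPairL w (T (b p)) = 0) →
      (∀ p, p ∉ S → hPairL w (v p) = 0) → w = 0 := fun w h1 h2 =>
    eq_zero_of_hPairL_basis b T w fun p => by
      by_cases hp : p ∈ S
      · exact h1 p hp
      · rw [hT p (hS p hp)]; exact h2 p hp
  have hnull : ∀ w ∈ nullF h, ∀ p, hPairL w (v p) = 0 := fun w hw p => by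
    refine hv₂ w p ?_
    have : charF h w = fun _ => 0 := funext (mem_nullF.1 hw)
    rw [this, analyticOrderAt_eq_top.2 (.of_forall fun _ => rfl)]
    exact le_top
  let Λ : HSpace m →ₗ[ℂ] (S → ℂ) := LinearMap.pi fun p => hPairR (T (b p))
  have hΛ : ∀ w p, Λ w p = hPairL w (T (b p)) := fun _ _ => rfl
  -- Null vectors annihilate every v_p, so the finitely many functionals from p ∈ S separate them.
  have hfd : FiniteDimensional ℂ (nullF h) := by
    refine Module.Finite.of_injective (Λ.comp (nullF h).subtype) ?_
    rw [injective_iff_map_eq_zero]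
    intro w hw
    refine Subtype.ext (hinj w.1 (fun p hp => ?_) fun p _ => hnull _ w.2 p)
    exact congrFun hw ⟨p, hp⟩
  have hbot := nullF_eq_bot h hh
  let D := S.card
  -- Cofactors of degrees 0, …, D are monic of distinct degrees, so no nontrivial combination of
  -- them vanishes; D + 1 unknowns outnumber the D conditions from S.
  have hsub : ∀ i : Fin (D + 1), ∃ t ⊆ S, t.card = D - i := fun i =>
    Finset.exists_subset_card_eq (Nat.sub_le _ _)
  choose t htS htc using hsub
  choose y hy using fun i => exists_charF_prod_div h hh hfin' f (hv₁ f hf) (t i)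
  let q : Fin (D + 1) → Polynomial ℂ := fun i =>
    ∏ p ∈ S \ t i, (Polynomial.X - Polynomial.C (lam p.1 p.2))
  have hqm : ∀ i, (q i).Monic := fun i =>
    Polynomial.monic_prod_of_monic _ _ fun p _ => Polynomial.monic_X_sub_C _
  have hqd : ∀ i, (q i).natDegree = i := fun i => by
    rw [Polynomial.natDegree_prod_of_monic _ _ fun p _ => Polynomial.monic_X_sub_C _]
    simp only [Polynomial.natDegree_X_sub_C, Finset.sum_const, smul_eq_mul, mul_one]
    rw [Finset.card_sdiff_of_subset (htS i), htc]
    have := i.2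
    omega
  let Ψ : (Fin (D + 1) → ℂ) →ₗ[ℂ] HSpace m := Fintype.linearCombination ℂ y
  obtain ⟨c, hcker, hc⟩ := (Submodule.ne_bot_iff _).1
    (LinearMap.ker_ne_bot_of_finrank_lt (f := Λ.comp Ψ) (by simp [D]))
  set w := Ψ c with hw
  let Q : Polynomial ℂ := ∑ i, Polynomial.C (c i) * q i
  have hQ : Q ≠ 0 := sum_ne_zero_of_natDegree q hqm hqd c hc
  have hFw : ∀ μ, (∏ p ∈ S, (μ - lam p.1 p.2)) * charF h w μ = Q.eval μ * charF h f μ := fun μ => by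
    have e1 : charF h w μ = ∑ i, c i * charF h (y i) μ := by
      have : charL h μ w = ∑ i, c i * charL h μ (y i) := by
        simp [hw, Ψ, Fintype.linearCombination_apply]
      exact this
    rw [e1, Polynomial.eval_finsetSum, Finset.mul_sum, Finset.sum_mul]
    refine Finset.sum_congr rfl fun i _ => ?_
    rw [Polynomial.eval_mul, Polynomial.eval_C, Polynomial.eval_prod, hy i μ,
      ← Finset.prod_sdiff (htS i)]
    simp only [Polynomial.eval_sub, Polynomial.eval_X, Polynomial.eval_C]
    ring
  -- For p ∉ S the product over S does not vanish at λ_p, so there F_w has the order of Q F_f, at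
  -- least that of F_f. The conditions for p ∈ S hold by the choice of c.
  have hw0 : w = 0 := by
    refine hinj w (fun p hp => congrFun hcker ⟨p, hp⟩) fun p hp => hv₂ w p ?_
    set μ₀ := lam p.1 p.2
    have a1 : AnalyticAt ℂ (charF h w) μ₀ := (differentiable_charF h w).analyticAt μ₀
    have a2 : AnalyticAt ℂ (charF h f) μ₀ := (differentiable_charF h f).analyticAt μ₀
    have a3 : AnalyticAt ℂ (fun μ => ∏ p ∈ S, (μ - lam p.1 p.2)) μ₀ :=
      Finset.analyticAt_fun_prod _ fun p _ => by fun_prop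
    have a4 : AnalyticAt ℂ (fun μ => Q.eval μ) μ₀ := Q.differentiable.analyticAt μ₀
    rw [← analyticOrderAt_mul_of_ne_zero a3 a1 (Finset.prod_ne_zero_iff.2 fun r hr => by
      rw [sub_ne_zero]
      intro h0
      have := hS p hp
      have := hS' r hr
      rw [← h0] at this
      linarith), funext hFw]
    refine (hv₁ f hf μ₀).trans ?_
    have := analyticOrderAt_mul a4 a2
    change analyticOrderAt (fun μ => Q.eval μ * charF h f μ) μ₀ = _ at this
    rw [this]
    exact le_add_self
  have hf0 : f ∈ nullF h := mem_nullF.2 fun μ => by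
    refine eq_zero_of_mul_eq_zero_off_finite (differentiable_charF h f).continuous
      (Q.roots.toFinset.finite_toSet) (p := fun μ => Q.eval μ) (fun μ hμ h0 => hμ ?_)
      (fun μ => ?_) μ
    · simpa [hQ] using h0
    · have e0 : charF h 0 μ = 0 := map_zero (charL h μ)
      rw [← hFw, hw0, e0, mul_zero]
  rw [hbot] at hf0
  exact (Submodule.mem_bot ℂ).1 hf0

end

/-! ### Assembly of the Riesz basis. -/

section

open MeasureTheory Filter Asymptotics Topology

variable {m : ℕ}

theorem exists_vFun_continuous (h : Fin m → ℂ) (hh : Function.Injective h)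
    (hZ : ∀ j, h j ∉ exceptionalSet) (lam : ℕ → Fin m → ℂ)
    (hfin : ∀ μ, (valueSet lam μ).Finite) :
    ∃ V : ℕ → Fin m → Fin m → CPi,
      (∀ n k j (x : Set.Icc 0 Real.pi), vFun h lam n k j x = V n k j x) ∧
      (∀ f : HSpace m, (∀ p : ℕ × Fin m, hPair f (V p.1 p.2) = 0) → ∀ μ,
        ((valueSet lam μ).ncard : ℕ∞) ≤ analyticOrderAt (charF h f) μ) ∧
      ∀ (f : HSpace m) (p : ℕ × Fin m), ((valueSet lam (lam p.1 p.2)).ncard : ℕ∞) ≤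
        analyticOrderAt (charF h f) (lam p.1 p.2) → hPair f (V p.1 p.2) = 0 := by
  choose w hw₁ hw₂ using exists_chainC h hh hZ
  let c : ℕ → Fin m → ℂ := fun n k =>
    if k.val = 0 then (-1) ^ n else (-1) ^ n / ((n : ℂ) + 1 / 2)
  have hc : ∀ n k, c n k ≠ 0 := fun n k => by
    have h1 : ((-1 : ℂ) ^ n) ≠ 0 := pow_ne_zero _ (by norm_num)
    simp only [c]
    split_ifs
    · exact h1
    · exact div_ne_zero h1 (natCast_add_half_ne_zero n)
  have hpair : ∀ (f : HSpace m) n k, hPair f (fun j => c n k • w (lam n k) (chainPos lam n k) j) =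
      c n k * hPair f (w (lam n k) (chainPos lam n k)) := fun f n k => by
    simp [hPair, Finset.mul_sum]
  refine ⟨fun n k j => c n k • w (lam n k) (chainPos lam n k) j, fun n k j x => ?_,
    fun f hf μ => ?_, fun f p hp => ?_⟩
  · simp only [vFun, yFun, ContinuousMap.smul_apply, ← hw₁, c, smul_eq_mul]
    split_ifs <;> rfl
  · refine (hw₂ μ f _).1 fun ν hν => ?_
    obtain ⟨p, hp, hpν⟩ := exists_chainPos_eq hfin μ hν
    have := hf p
    rw [hpair, hp, hpν] at this
    exact (mul_eq_zero.1 this).resolve_left (hc _ _)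
  · rw [hpair, (hw₂ _ f _).2 hp _ (chainPos_lt_ncard hfin p), mul_zero]

theorem summable_sq_of_isBigO {v v₀ : ℕ × Fin m → HSpace m}
    (hv : ∀ k j, (fun n => v (n, k) j - v₀ (n, k) j) =O[atTop] fun n : ℕ => (n : ℝ)⁻¹) :
    Summable fun p => ‖v p - v₀ p‖ ^ 2 := by
  have hs : Summable fun q : Fin m × ℕ => ‖v (q.2, q.1) - v₀ (q.2, q.1)‖ ^ 2 := by
    refine (summable_prod_of_nonneg (fun _ => sq_nonneg _)).2 ⟨fun k => ?_, Summable.of_finite⟩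
    simp only [PiLp.norm_sq_eq_of_L2, PiLp.sub_apply]
    refine summable_sum fun j _ => ?_
    refine summable_of_isBigO_nat (Real.summable_one_div_nat_pow.2 one_lt_two) ?_
    refine ((hv k j).norm_left.pow 2).congr_right fun n => by simp
  exact (Equiv.prodComm ℕ (Fin m)).summable_iff.2 hs

theorem isRieszBasis_of_vFun (hm : 2 ≤ m) (h : Fin m → ℂ) (hstar : CStar h)
    (hZ : ∀ j, h j ∉ exceptionalSet) (z : Fin m → ℂ) (hz : IsZNumbers h z)
    (lam : ℕ → Fin m → ℂ) (hlam : HasAsymptotics z lam) :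
    ∃ V : ℕ → Fin m → Fin m → CPi,
      (∀ n k j (x : Set.Icc 0 Real.pi), vFun h lam n k j x = V n k j x) ∧
      IsRieszBasis (fun p : ℕ × Fin m =>
        (WithLp.toLp 2 fun j => toL2 (V p.1 p.2 j) : HSpace m)) := by
  obtain ⟨hh, hnodup, hnot⟩ := hstar
  have hzmem : ∀ k : Fin m, k.val ≠ 0 → z k ∈ (critPoly h).roots := fun k hk => by
    rw [← hz.2]
    exact Multiset.mem_map_of_mem z (by simpa using hk)
  have hzinj : ∀ k l : Fin m, k.val ≠ 0 → l.val ≠ 0 → z k = z l → k = l := fun k l hk hl hkl => by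
    rw [← hz.2] at hnodup
    exact Multiset.inj_on_of_nodup_map hnodup k (by simpa using hk) l (by simpa using hl) hkl
  have hhz : ∀ j k : Fin m, k.val ≠ 0 → h j ≠ z k := fun j k hk he =>
    hnot j (he ▸ hzmem k hk)
  have hfin := finite_setOf_norm_lam_le hlam
  have hfin' : ∀ μ, (valueSet lam μ).Finite := fun μ =>
    (hfin ‖μ‖).subset fun p (hp : lam p.1 p.2 = μ) => by simp [hp]
  obtain ⟨V, hV, hV₁, hV₂⟩ := exists_vFun_continuous h hh hZ lam hfin'
  refine ⟨V, hV, ?_⟩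
  set v : ℕ × Fin m → HSpace m := fun p => WithLp.toLp 2 fun j => toL2 (V p.1 p.2 j) with hv
  have hA : IsUnit (limMat h z) := by
    have hk0 : ∀ k : Fin m, k = ⟨0, by omega⟩ ↔ k.val = 0 := fun k => Fin.ext_iff
    have := isUnit_cauchy h z hh ⟨0, by omega⟩
      (fun k l hk hl => hzinj k l (fun h => hk ((hk0 k).2 h)) (fun h => hl ((hk0 l).2 h)))
      (fun j k hk => hhz j k fun h => hk ((hk0 k).2 h))
    simp only [hk0] at this
    convert! this
  obtain ⟨b, T₀, hT₀⟩ := exists_base_hilbertBasis shift shift_cases (limMat h z) hA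
  have hsum : Summable fun p => ‖v p - T₀ (b p)‖ ^ 2 := by
    refine summable_sq_of_isBigO fun k j => ?_
    have h1 := (toL2.isBigO_comp (fun n => V n k j - limMat h z j k • cosC (shift k) n)
      atTop).trans (vFun_sub_isBigO hlam hzinj hhz V hV k j)
    refine h1.congr' ?_ (.of_forall fun _ => rfl)
    filter_upwards [eventually_ge_atTop 1] with n hn
    rw [hT₀ n k hn]
    simp [hv]
  obtain ⟨S₀, hS₀⟩ := exists_equiv_of_quadratically_close b T₀ v hsum
  obtain ⟨R, hR⟩ := (S₀.finite_toSet.image fun p => ‖lam p.1 p.2‖).bddAbove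
  -- The exceptional finite set is enlarged to a disc of values, as the completeness argument
  -- requires.
  obtain ⟨T, -, hT⟩ := hS₀ (hfin R).toFinset fun p hp => by
    simpa using hR ⟨p, hp, rfl⟩
  have hcomplete := eq_zero_of_annihilates h hh hfin v
    (fun f hf => hV₁ f fun p => by rw [← hf p, hv, hPairL_toLp])
    (fun f p hp => by rw [hv, hPairL_toLp]; exact hV₂ f p hp) b T R
    (fun p hp => hT p (by simpa using hp))
  refine isRieszBasis_of_finite_change b T v (hfin R).toFinset (fun p hp => (hT p hp).symm) ?_
  rw [Submodule.topologicalClosure_eq_top_iff, Submodule.eq_bot_iff]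
  intro g hg
  -- Completeness was proved for the bilinear pairing; conjugation translates it to the inner
  -- product.
  have : conjH g = 0 := hcomplete _ fun p => by
    rw [hPairL_conjH]
    exact Submodule.inner_left_of_mem_orthogonal (Submodule.subset_span (Set.mem_range_self p)) hg
  rw [← conjH_conjH g, this]
  ext1 j
  simp only [conjH, PiLp.zero_apply]
  rw [← norm_eq_zero, norm_star_Lp, norm_zero]

end

end StarGraph

end

theorem mainTheorem3 (m : ℕ) (hm : 2 ≤ m) (h : Fin m → ℂ)
    (hstar : StarGraph.CStar h) (hZ : ∀ j, h j ∉ StarGraph.exceptionalSet)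
    (z : Fin m → ℂ) (hz : StarGraph.IsZNumbers h z)
    (lam : ℕ → Fin m → ℂ) (hlam : StarGraph.HasAsymptotics z lam) :
    ∃ hv : ∀ (n : ℕ) (k j : Fin m),
        MeasureTheory.MemLp (StarGraph.vFun h lam n k j) 2 StarGraph.volPi,
      StarGraph.IsRieszBasis (fun p : ℕ × Fin m =>
        (WithLp.toLp 2 (fun j : Fin m => (hv p.1 p.2 j).toLp (StarGraph.vFun h lam p.1 p.2 j)) :
          StarGraph.HSpace m)) := by
  obtain ⟨V, hV, hR⟩ := StarGraph.isRieszBasis_of_vFun hm h hstar hZ z hz lam hlam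
  have hae : ∀ n k j, StarGraph.extPi (V n k j) =ᵐ[StarGraph.volPi] StarGraph.vFun h lam n k j :=
    fun n k j => by
      filter_upwards [MeasureTheory.ae_restrict_mem measurableSet_Ioo] with x hx
      rw [StarGraph.extPi_of_mem _ (Set.Ioo_subset_Icc_self hx), ← hV]
  refine ⟨fun n k j => (StarGraph.memLp_extPi (V n k j)).ae_eq (hae n k j), ?_⟩
  convert! hR using 4 with p j
  exact (MeasureTheory.MemLp.toLp_eq_toLp_iff _ (StarGraph.memLp_extPi (V p.1 p.2 j))).2
    (hae _ _ _).symm
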